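/- Let $\mathcal H$ be a separable real Hilbert space, $d\ge 0$ an integer, $V>0$ and $0<\tau<1$. A closed set $\mathcal M\subseteq\mathcal H$ is a (boundaryless) $d$-dimensional $C^2$ submanifold if every $p\in\mathcal M$ has an open neighbourhood $U$ in $\mathcal H$ and a $C^2$ diffeomorphism $\phi$ of $U$ onto an open subset of $\mathcal H$ such that $\phi(\mathcal M\cap U)$ is the intersection of $\phi(U)$ with a $d$-dimensional affine subspace. The reach of $\mathcal M$ is the largest number $\rho\in[0,\infty]$ such that every point of $\mathcal H$ at distance less than $\rho$ from $\mathcal M$ has a unique nearest point in $\mathcal M$. Let $\mathcal G(d,V,\tau)$ be the family of $d$-dimensional $C^2$ submanifolds of $\mathcal H$ that are contained in the closed unit ball, have $d$-dimensional volume at most $V$ and reach at least $\tau$. An $r$-net of $\mathcal M$ is a subset $S\subseteq\mathcal M$ such that every point of $\mathcal M$ is at distance less than $r$ from some point of $S$. For every $d$ and every constant $c>0$ there is a constant $C>0$, depending only on $d$ and $c$, such that the following holds for all $\mathcal H$, $V>0$, $0<\tau<1$ and $\varepsilon>0$. Let $\mathcal M\in\mathcal G(d,V,\tau)$, let $S$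 be a $c\varepsilon\tau$-net of $\mathcal M$, and let $\Pi$ be the orthogonal projection of $\mathcal H$ onto a closed subspace containing the linear span of $S$. Then $$|\Pi(x-y)|\ \ge\ (1-C\sqrt{\varepsilon})\,|x-y|\qquad\text{for all }x,y\in\mathcal M,$$ and, if $C\sqrt{\varepsilon}<1$, then $\Pi(\mathcal M)$ is a $d$-dimensional $C^2$ submanifold of $\mathcal H$ and $$\Pi(\mathcal M)\in\mathcal G\bigl(d,V,\tau(1-C\sqrt{\varepsilon})\bigr).$$ -/

import Mathlib

open scoped ENNReal MeasureTheory

noncomputable section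

namespace ManifoldApprox

/-- `Y` is an `r`-net of `X`: `Y ⊆ X` and every point of `X` is at distance `< r` from some point
of `Y`. -/
def IsNet {E : Type*} [PseudoMetricSpace E] (r : ℝ) (Y X : Set E) : Prop :=
  Y ⊆ X ∧ ∀ x ∈ X, ∃ y ∈ Y, dist x y < r

/-- The reach of a set `M`: the largest `ρ ∈ [0, ∞]` such that every point of the ambient space at
distance `< ρ` from `M` has a unique nearest point in `M`. -/
def reach {E : Type*} [PseudoEMetricSpace E] (M : Set E) : ℝ≥0∞ :=
  sSup {ρ : ℝ≥0∞ | ∀ x : E, Metric.infEDist x M < ρ →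
    ∃! y : E, y ∈ M ∧ edist x y = Metric.infEDist x M}

/-- `M` is a closed (boundaryless) `d`-dimensional `C^r` submanifold of the Hilbert space `H`:
`M` is closed and around every point `p ∈ M` there is a `C^r` diffeomorphism `φ` from an open
neighbourhood `U` of `p` onto an open subset of `H` such that `φ (M ∩ U)` is the intersection of
`φ U` with a `d`-dimensional affine subspace. -/
def IsSubmanifold {H : Type*} [NormedAddCommGroup H] [InnerProductSpace ℝ H]
    (r : WithTop ℕ∞) (d : ℕ) (M : Set H) : Prop :=
  IsClosed M ∧ ∀ p ∈ M, ∃ (φ : OpenPartialHomeomorph H H) (A : AffineSubspace ℝ H),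
    p ∈ φ.source ∧
    ContDiffOn ℝ r φ φ.source ∧
    ContDiffOn ℝ r φ.symm φ.target ∧
    Module.rank ℝ A.direction = (d : Cardinal) ∧
    φ '' (M ∩ φ.source) = (A : Set H) ∩ φ.target

/-- The class `𝒢(d, V, τ)` of boundaryless `d`-dimensional `C²` submanifolds of the closed unit
ball of `H` with `d`-dimensional volume at most `V` and reach at least `τ`. The volume is the
`d`-dimensional Hausdorff measure, normalized to agree with Lebesgue measure on `ℝ^d`. -/
def manifoldClass (H : Type*) [NormedAddCommGroup H] [InnerProductSpace ℝ H]
    [MeasurableSpace H] [BorelSpace H] (d : ℕ) (V τ : ℝ) : Set (Set H) :=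
  {M | IsSubmanifold 2 d M ∧ M ⊆ Metric.closedBall 0 1 ∧
    μHE[d] M ≤ ENNReal.ofReal V ∧ ENNReal.ofReal τ ≤ reach M}

end ManifoldApprox

end

/-!
The projection almost preserves distances because it almost preserves secants, and a short secant
is almost tangent. If `x, y ∈ M` are at distance at least `√ε τ`, replacing them by points of the
net costs at most `2cετ ≤ 2c√ε |x - y|`. If they are closer, `y - x` is within
`|y - x|² / (2τ) ≤ √ε |y - x|` of the tangent space `T` at `x`, and a unit tangent vector `v` is in
turn a secant up to `O(√ε)`, since `x + √ε τ v` lies within `2ετ` of `M`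
(`UniformRollingBall.exists_near`).

Both facts rest on the rolling ball condition `⟪n, y - p⟫ ≤ |n| |y - p|² / (2τ)` for normals `n`
at `p`, which says that `M` avoids the open balls of radius `τ` tangent to it at `p`
(`IsTangentParam.rollingBall`). Following Federer, a normal ray from `p` realizes the distance to
`M` up to time `τ`: from a presumed stopping point, an almost steepest ascent of the distance
function leads to points at a fixed small distance, which converge to a point of the ray as the
ascent rate tends to one, so the ray does not stop there. Ekeland's variational principle
(`exists_ascent_maximal`) provides these points; Federer's compactness argument for an ordinary
differential equation is not available in infinite dimensions. To pass from the rolling ball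
condition to `UniformRollingBall.exists_near`, the function `t ↦ dist (p + t v) M` is shown to
satisfy a differential inequality: the displacement of `p + t v` from its nearest point `z` is
normal at `z`, while `p - z` is almost tangent there.

The nearest point map has to be continuous for this argument, and in infinite dimensions uniqueness
of nearest points alone does not obviously give it; compactness of `M` does. It comes from the
volume bound (`isCompact_of_hasUniqueNearest`): where `M ∩ closedBall q (4ρ)` is compact the
argument above applies locally and bounds the volume of `M` near `q` from below by a
constant depending on `d` and `ρ` only, so finitely many such pieces cover a ball. Hence a ball in
which `M` is not compact contains the centre of a noncompact ball of half the radius, and iterating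
contradicts local compactness of `M` at the limit of the centres.

For the image, `Π` composed with the parametrization of `M` by `T` extends to a local diffeomorphism
of `H` since `id - (id - Π) P_T` is invertible; the rolling ball condition passes to `Π(M)` with
constant `τ (1 - C√ε)`, which yields unique nearest points within that distance
(`hasUniqueNearest_image`). The constant `C = 3 + 2c` works in every dimension.
-/

namespace ManifoldApprox

open Filter Topology Metric Set RealInnerProductSpace MeasureTheory

/-! ### Local parametrization by the tangent space -/

section TangentParam

variable {H : Type*} [NormedAddCommGroup H] [InnerProductSpace ℝ H]

/-- `g` is a `C²` parametrization of `M` near `p` by the tangent space `T`: near `0`, it maps `T`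
onto a neighbourhood of `p` in `M`, and `g y = p + y + o(y)`. It is defined on all of `H`, so that
differentiability can be expressed at points of `H`, but only its values on `T` matter. -/
structure IsTangentParam (M : Set H) (p : H) (T : Submodule ℝ H) (g : H → H) : Prop where
  contDiffAt : ContDiffAt ℝ 2 g 0
  map_zero : g 0 = p
  hasFDerivAt : HasFDerivAt g (ContinuousLinearMap.id ℝ H) 0
  mapsTo : ∀ᶠ y in 𝓝 (0 : H), y ∈ T → g y ∈ M
  surj : ∀ O ∈ 𝓝 (0 : H), ∀ᶠ m in 𝓝 p, m ∈ M → ∃ y ∈ O, y ∈ T ∧ g y = m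

theorem IsSubmanifold.exists_isTangentParam {d : ℕ} {M : Set H} (hM : IsSubmanifold 2 d M)
    {p : H} (hp : p ∈ M) :
    ∃ (T : Submodule ℝ H) (g : H → H), Module.rank ℝ T = d ∧ IsTangentParam M p T g := by
  obtain ⟨φ, A, hps, hφ, hψ, hA, himg⟩ := hM.2 p hp
  have hpt : φ p ∈ φ.target := φ.map_source hps
  have hpA : φ p ∈ A := (himg.subset ⟨p, ⟨hp, hps⟩, rfl⟩).1
  have hφp : ContDiffAt ℝ 2 φ p := hφ.contDiffAt (φ.open_source.mem_nhds hps)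
  have hψp : ContDiffAt ℝ 2 φ.symm (φ p) := hψ.contDiffAt (φ.open_target.mem_nhds hpt)
  set D := fderiv ℝ φ p with hD
  set E := fderiv ℝ φ.symm (φ p) with hE
  have hDd : HasFDerivAt φ D p := (hφp.differentiableAt (by simp)).hasFDerivAt
  have hEd : HasFDerivAt φ.symm E (φ p) := (hψp.differentiableAt (by simp)).hasFDerivAt
  have hED : E.comp D = ContinuousLinearMap.id ℝ H := by
    refine (hEd.comp p hDd).unique ((hasFDerivAt_id p).congr_of_eventuallyEq ?_)
    filter_upwards [φ.open_source.mem_nhds hps] with x hx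
    simp [φ.left_inv hx]
  have hDE : D.comp E = ContinuousLinearMap.id ℝ H := by
    have hDd' : HasFDerivAt φ D (φ.symm (φ p)) := by rwa [φ.left_inv hps]
    refine (hDd'.comp (φ p) hEd).unique ((hasFDerivAt_id _).congr_of_eventuallyEq ?_)
    filter_upwards [φ.open_target.mem_nhds hpt] with x hx
    simp [φ.right_inv hx]
  have hED' : ∀ x, E (D x) = x := fun x => by simpa using congr($hED x)
  have hDE' : ∀ x, D (E x) = x := fun x => by simpa using congr($hDE x)
  let e : H ≃L[ℝ] H := ContinuousLinearEquiv.equivOfInverse E D hDE' hED'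
  have hshift : Tendsto (fun y : H => φ p + D y) (𝓝 0) (𝓝 (φ p)) := by
    have : Continuous (fun y : H => φ p + D y) := by fun_prop
    simpa using this.tendsto 0
  refine ⟨A.direction.map (e.toLinearEquiv : H →ₗ[ℝ] H), fun y => φ.symm (φ p + D y), ?_, ?_⟩
  · rw [LinearEquiv.rank_map_eq, hA]
  · refine ⟨?_, ?_, ?_, ?_, ?_⟩
    · have h1 : ContDiffAt ℝ 2 (fun y : H => φ p + D y) 0 := by fun_prop
      exact ContDiffAt.comp (0 : H) (by simpa using hψp) h1
    · simp [φ.left_inv hps]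
    · have h1 : HasFDerivAt (fun y : H => φ p + D y) D 0 := D.hasFDerivAt.const_add _
      have h2 : HasFDerivAt φ.symm E (φ p + D 0) := by simpa using hEd
      have := h2.comp (0 : H) h1
      rwa [hED] at this
    · filter_upwards [hshift.eventually_mem (φ.open_target.mem_nhds hpt)] with y hy hyT
      obtain ⟨a, ha, rfl⟩ := hyT
      have hDa : D ((e.toLinearEquiv : H →ₗ[ℝ] H) a) = a := hDE' a
      rw [hDa] at hy ⊢
      have : φ p + a ∈ (A : Set H) := by
        have := AffineSubspace.vadd_mem_of_mem_direction ha hpA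
        simpa [add_comm] using this
      obtain ⟨m, ⟨hm, hms⟩, hmeq⟩ := himg.superset ⟨this, hy⟩
      rw [← hmeq, φ.left_inv hms]
      exact hm
    · intro O hO
      have hcont : ContinuousAt (fun m => E (φ m - φ p)) p :=
        E.continuous.continuousAt.comp ((φ.continuousAt hps).sub continuousAt_const)
      have h0 : O ∈ 𝓝 ((fun m => E (φ m - φ p)) p) := by simpa using hO
      filter_upwards [hcont.preimage_mem_nhds h0, φ.open_source.mem_nhds hps] with m hmO hms hmM
      have hmA : φ m ∈ A := (himg.subset ⟨m, ⟨hmM, hms⟩, rfl⟩).1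
      refine ⟨E (φ m - φ p), hmO, ⟨φ m - φ p, ?_, rfl⟩, ?_⟩
      · simpa using AffineSubspace.vsub_mem_direction hmA hpA
      · simp [hDE', φ.left_inv hms]

namespace IsTangentParam

variable {M : Set H} {p : H} {T : Submodule ℝ H} {g : H → H}

theorem continuousAt (h : IsTangentParam M p T g) : ContinuousAt g 0 := h.contDiffAt.continuousAt

/-- The second order Taylor estimate for the parametrization. -/
theorem exists_norm_sub_le (h : IsTangentParam M p T g) :
    ∃ K : ℝ, 0 ≤ K ∧ ∀ᶠ y in 𝓝 (0 : H), ‖g y - p - y‖ ≤ K * ‖y‖ ^ 2 := by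
  have h1 : ContDiffAt ℝ 1 (fderiv ℝ g) 0 := h.contDiffAt.fderiv_right (by norm_num)
  obtain ⟨K, s, hs, hK⟩ := h1.exists_lipschitzOnWith
  obtain ⟨u, hu, hgu⟩ := h.contDiffAt.contDiffOn le_rfl (by simp)
  have hdiff : ∀ᶠ y in 𝓝 (0 : H), DifferentiableAt ℝ g y := by
    filter_upwards [eventually_mem_nhds_iff.2 hu] with y hy
    exact (hgu.contDiffAt hy).differentiableAt (by simp)
  obtain ⟨r, hr, hball⟩ := Metric.eventually_nhds_iff_ball.1 (hdiff.and hs)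
  refine ⟨K, K.2, ?_⟩
  filter_upwards [Metric.ball_mem_nhds (0 : H) hr] with y hy
  have hyr : ‖y‖ < r := by simpa using hy
  have hsub : ∀ x ∈ closedBall (0 : H) ‖y‖, x ∈ ball (0 : H) r := fun x hx => by
    simp only [mem_closedBall, dist_zero_right, mem_ball] at hx ⊢
    exact hx.trans_lt hyr
  have key := (convex_closedBall (0 : H) ‖y‖).norm_image_sub_le_of_norm_hasFDerivWithin_le'
    (f := g) (f' := fderiv ℝ g) (φ := ContinuousLinearMap.id ℝ H) (C := K * ‖y‖) (x := 0) (y := y)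
    (fun x hx => ((hball x (hsub x hx)).1).hasFDerivAt.hasFDerivWithinAt)
    (fun x hx => ?_) (by simp) (by simp)
  · simpa [h.map_zero, pow_two, mul_assoc] using key
  · have h2 := hK.norm_sub_le (hball x (hsub x hx)).2 (hball 0 (by simpa using hr)).2
    rw [h.hasFDerivAt.fderiv, sub_zero] at h2
    refine h2.trans ?_
    gcongr
    simpa using hx

/-- `M` stays close to its tangent space to second order. -/
theorem exists_quadratic (h : IsTangentParam M p T g) :
    ∃ K : ℝ, 0 ≤ K ∧ ∀ᶠ m in 𝓝 p, m ∈ M → ∃ w ∈ T, ‖m - p - w‖ ≤ K * ‖m - p‖ ^ 2 := by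
  obtain ⟨K, hK, hg⟩ := h.exists_norm_sub_le
  have hsmall : ∀ᶠ y in 𝓝 (0 : H), K * ‖y‖ ≤ 1 / 2 := by
    have : Tendsto (fun y : H => K * ‖y‖) (𝓝 0) (𝓝 0) := by
      have : Continuous (fun y : H => K * ‖y‖) := by fun_prop
      simpa using this.tendsto 0
    exact this.eventually_le_const (by norm_num)
  refine ⟨4 * K, by positivity, ?_⟩
  filter_upwards [h.surj _ (hg.and hsmall)] with m hm hmM
  obtain ⟨y, ⟨hy1, hy2⟩, hyT, rfl⟩ := hm hmM
  refine ⟨y, hyT, hy1.trans ?_⟩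
  have h1 : ‖y‖ ≤ ‖g y - p‖ + ‖g y - p - y‖ := by
    have := norm_sub_le (g y - p) (g y - p - y)
    simpa using this
  have h2 : ‖y‖ ≤ 2 * ‖g y - p‖ := by nlinarith [norm_nonneg y]
  calc K * ‖y‖ ^ 2 ≤ K * (2 * ‖g y - p‖) ^ 2 := by gcongr
    _ = 4 * K * ‖g y - p‖ ^ 2 := by ring

theorem eventually_norm_sub_le (h : IsTangentParam M p T g) {v : H} (hv : v ∈ T) {η : ℝ}
    (hη : 0 < η) : ∀ᶠ t in 𝓝[>] (0 : ℝ), ∃ y ∈ M, ‖p + t • v - y‖ ≤ η * t := by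
  obtain ⟨K, hK, hg⟩ := h.exists_norm_sub_le
  have ht : Tendsto (fun t : ℝ => t • v) (𝓝[>] 0) (𝓝 0) := by
    have : Continuous (fun t : ℝ => t • v) := by fun_prop
    simpa using (this.tendsto 0).mono_left nhdsWithin_le_nhds
  have ht2 : ∀ᶠ t in 𝓝[>] (0 : ℝ), K * t * ‖v‖ ^ 2 ≤ η := by
    have : Tendsto (fun t : ℝ => K * t * ‖v‖ ^ 2) (𝓝 0) (𝓝 0) := by
      have : Continuous (fun t : ℝ => K * t * ‖v‖ ^ 2) := by fun_prop
      simpa using this.tendsto 0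
    exact nhdsWithin_le_nhds (this.eventually_le_const hη)
  filter_upwards [ht.eventually (hg.and h.mapsTo), ht2, self_mem_nhdsWithin] with t h1 h2 h3
  have h3 : 0 < t := h3
  refine ⟨g (t • v), h1.2 (T.smul_mem _ hv), ?_⟩
  have h4 : ‖p + t • v - g (t • v)‖ = ‖g (t • v) - p - t • v‖ := by
    rw [← norm_neg]; congr 1; abel
  rw [h4]
  refine h1.1.trans ?_
  rw [norm_smul, Real.norm_of_nonneg h3.le]
  nlinarith

/-- A function with a local minimum along `M` at `p` has derivative vanishing on the tangent
space. -/
theorem fderiv_eq_zero (h : IsTangentParam M p T g) {f : H → ℝ} {f' : H →L[ℝ] ℝ}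
    (hmin : IsLocalMinOn f M p) (hf : HasFDerivAt f f' p) {v : H} (hv : v ∈ T) : f' v = 0 := by
  have hg1 : HasDerivAt (fun t : ℝ => g (t • v)) v 0 := by
    have h1 : HasDerivAt (fun t : ℝ => t • v) v 0 := by
      simpa using (hasDerivAt_id (0 : ℝ)).smul_const v
    have h2 : HasFDerivAt g (ContinuousLinearMap.id ℝ H) ((0 : ℝ) • v) := by
      simpa using h.hasFDerivAt
    simpa [Function.comp_def] using h2.comp_hasDerivAt (0 : ℝ) h1
  have hg0 : g ((0 : ℝ) • v) = p := by simp [h.map_zero]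
  have h3 : HasDerivAt (fun t : ℝ => f (g (t • v))) (f' v) 0 :=
    HasFDerivAt.comp_hasDerivAt (0 : ℝ) (by rwa [hg0]) hg1
  refine IsLocalMin.hasDerivAt_eq_zero ?_ h3
  have ht : Tendsto (fun t : ℝ => t • v) (𝓝 0) (𝓝 0) := by
    have : Continuous (fun t : ℝ => t • v) := by fun_prop
    simpa using this.tendsto 0
  have hgt : Tendsto (fun t : ℝ => g (t • v)) (𝓝 0) (𝓝 p) := by
    simpa [h.map_zero, Function.comp_def] using h.continuousAt.tendsto.comp ht
  have hm : ∀ᶠ t in 𝓝 (0 : ℝ), g (t • v) ∈ M := by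
    filter_upwards [ht.eventually h.mapsTo] with t h1 using h1 (T.smul_mem _ hv)
  have := (tendsto_nhdsWithin_iff.2 ⟨hgt, hm⟩).eventually hmin
  filter_upwards [this] with t h4
  simpa [h.map_zero] using h4

/-- The displacement of a point from a nearest point of `M` is normal to `M`. -/
theorem sub_mem_orthogonal (h : IsTangentParam M p T g) {q : H}
    (hq : ∀ y ∈ M, ‖q - p‖ ≤ ‖q - y‖) : q - p ∈ Tᗮ := by
  rw [Submodule.mem_orthogonal']
  intro v hv
  have hf : HasFDerivAt (fun y => ‖q - y‖ ^ 2) (-(2 • innerSL ℝ (q - p))) p := by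
    have h1 : HasFDerivAt (fun y => q - y) (-(ContinuousLinearMap.id ℝ H)) p :=
      (hasFDerivAt_id p).const_sub q
    convert h1.norm_sq using 1
    ext; simp; ring
  have hmin : IsLocalMinOn (fun y => ‖q - y‖ ^ 2) M p :=
    eventually_nhdsWithin_of_forall fun y hy => by
      have := hq y hy
      show ‖q - p‖ ^ 2 ≤ ‖q - y‖ ^ 2
      gcongr
  have := h.fderiv_eq_zero hmin hf hv
  simpa [inner_sub_left] using this

/-- A submanifold is locally compact. -/
theorem exists_isCompact (h : IsTangentParam M p T g) (hM : IsClosed M) [FiniteDimensional ℝ T] :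
    ∃ r > 0, IsCompact (M ∩ closedBall p r) := by
  obtain ⟨u, hu, hgu⟩ := h.contDiffAt.contDiffOn le_rfl (by simp)
  obtain ⟨ρ, hρ, hρu⟩ := Metric.nhds_basis_closedBall.mem_iff.1 hu
  have hc : IsCompact ((T : Set H) ∩ closedBall 0 ρ) := by
    have : (T : Set H) ∩ closedBall 0 ρ = Subtype.val '' (closedBall (0 : T) ρ) := by
      ext x
      constructor
      · rintro ⟨hx, hx2⟩
        exact ⟨⟨x, hx⟩, by simpa using hx2, rfl⟩
      · rintro ⟨y, hy, rfl⟩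
        exact ⟨y.2, by simpa using hy⟩
    rw [this]
    exact (isCompact_closedBall (0 : T) ρ).image continuous_subtype_val
  have hc2 : IsCompact (g '' ((T : Set H) ∩ closedBall 0 ρ)) :=
    hc.image_of_continuousOn (hgu.continuousOn.mono (inter_subset_right.trans hρu))
  obtain ⟨r, hr, hball⟩ := Metric.nhds_basis_closedBall.mem_iff.1
    (h.surj _ (closedBall_mem_nhds (0 : H) hρ))
  refine ⟨r, hr, hc2.of_isClosed_subset (hM.inter isClosed_closedBall) ?_⟩
  rintro m ⟨hm, hmr⟩
  obtain ⟨y, hy, hyT, rfl⟩ := hball hmr hm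
  exact ⟨y, ⟨hyT, hy⟩, rfl⟩

end IsTangentParam

end TangentParam

/-! ### Ekeland's variational principle -/

/-- Ekeland's variational principle: from `x₀` one can reach, at ascent rate at least `l`, a point
`x` from which no other point can be reached at that rate. -/
theorem exists_ascent_maximal {X : Type*} [MetricSpace X] [CompleteSpace X] {S : Set X}
    (hS : IsClosed S) {f : X → ℝ} (hf : Continuous f) (hb : BddAbove (f '' S)) {l : ℝ} (hl : 0 < l)
    {x₀ : X} (hx₀ : x₀ ∈ S) :
    ∃ x ∈ S, l * dist x₀ x ≤ f x - f x₀ ∧ ∀ y ∈ S, l * dist x y ≤ f y - f x → y = x := by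
  -- `F x` is the set of points reachable from `x` at ascent rate `l`
  let F : X → Set X := fun x => {y | y ∈ S ∧ l * dist x y ≤ f y - f x}
  have hself : ∀ x ∈ S, x ∈ F x := fun x hx => ⟨hx, by simp⟩
  have htrans : ∀ {x y z}, y ∈ F x → z ∈ F y → z ∈ F x := by
    rintro x y z ⟨-, h1⟩ ⟨hz, h2⟩
    refine ⟨hz, ?_⟩
    have := dist_triangle x y z
    nlinarith
  have hbF : ∀ x, BddAbove (f '' F x) := fun x => hb.mono (image_mono fun y hy => hy.1)
  -- each step gains at least half of what can still be gained
  have hnext : ∀ x : S, ∃ y : S, y.1 ∈ F x ∧ sSup (f '' F x) ≤ 2 * f y - f x := by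
    rintro ⟨x, hx⟩
    by_cases hlt : f x < sSup (f '' F x)
    · obtain ⟨_, ⟨y, hy, rfl⟩, h⟩ := exists_lt_of_lt_csSup
        (show (f '' F x).Nonempty from ⟨f x, x, hself x hx, rfl⟩)
        (show (f x + sSup (f '' F x)) / 2 < sSup (f '' F x) by linarith)
      exact ⟨⟨y, hy.1⟩, hy, by simp only; linarith⟩
    · exact ⟨⟨x, hx⟩, hself x hx, by simp only; linarith⟩
  choose next hnF hns using hnext
  let u : ℕ → S := fun n => next^[n] ⟨x₀, hx₀⟩
  have husucc : ∀ n, u (n + 1) = next (u n) := fun n => Function.iterate_succ_apply' _ _ _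
  have huF : ∀ n k, (u (n + k)).1 ∈ F (u n) := by
    intro n k
    induction k with
    | zero => exact hself _ (u n).2
    | succ k ih =>
      rw [← add_assoc, husucc]
      exact htrans ih (hnF _)
  have huF' : ∀ {n m}, n ≤ m → (u m).1 ∈ F (u n) := fun {n m} h => by
    obtain ⟨k, rfl⟩ := Nat.exists_eq_add_of_le h
    exact huF n k
  have hmono : Monotone (fun n => f (u n)) := fun n m h => by
    have := (huF' h).2
    have h2 : 0 ≤ l * dist (u n).1 (u m) := by positivity
    simp only; linarith
  have hbdd : BddAbove (range fun n => f (u n)) :=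
    hb.mono (by rintro _ ⟨n, rfl⟩; exact ⟨u n, (u n).2, rfl⟩)
  have hlim := tendsto_atTop_ciSup hmono hbdd
  set L := ⨆ n, f (u n)
  have hle : ∀ n, f (u n) ≤ L := fun n => le_ciSup hbdd n
  have hcau : CauchySeq (fun n => (u n).1) := by
    refine cauchySeq_of_le_tendsto_0' (fun n => (L - f (u n)) / l) (fun n m hnm => ?_) ?_
    · rw [le_div_iff₀ hl]
      have := (huF' hnm).2
      have := hle m
      linarith
    · simpa using ((tendsto_const_nhds (x := L)).sub hlim).div_const l
  obtain ⟨x, hx⟩ := cauchySeq_tendsto_of_complete hcau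
  have hfx : Tendsto (fun n => f (u n)) atTop (𝓝 (f x)) := (hf.tendsto x).comp hx
  have hxS : x ∈ S := hS.mem_of_tendsto hx (Eventually.of_forall fun n => (u n).2)
  have hxF : ∀ n, x ∈ F (u n) := fun n => by
    refine ⟨hxS, le_of_tendsto_of_tendsto (tendsto_const_nhds.mul (tendsto_const_nhds.dist hx))
      (hfx.sub_const _) ?_⟩
    filter_upwards [eventually_ge_atTop n] with m hm using (huF' hm).2
  refine ⟨x, hxS, (hxF 0).2, fun y hy hxy => ?_⟩
  have hyF : ∀ n, y ∈ F (u n) := fun n => htrans (hxF n) ⟨hy, hxy⟩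
  have hfy : f y ≤ f x := by
    have h1 : ∀ n, f y ≤ 2 * f (u (n + 1)) - f (u n) := fun n => by
      rw [husucc]
      exact (le_csSup (hbF _) ⟨y, hyF n, rfl⟩).trans (hns _)
    have h2 : Tendsto (fun n => 2 * f (u (n + 1)) - f (u n)) atTop (𝓝 (2 * f x - f x)) :=
      ((hfx.comp (tendsto_add_atTop_nat 1)).const_mul 2).sub hfx
    have := ge_of_tendsto' h2 h1
    linarith
  have h3 : dist x y ≤ 0 := by
    by_contra! h
    have : 0 < l * dist x y := by positivity
    linarith
  exact (dist_le_zero.1 h3).symm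

/-! ### Federer's rolling ball condition -/

section Nearest

variable {H : Type*} [NormedAddCommGroup H]

/-- Every point at distance less than `τ` from `M` has a unique nearest point in `M`. Since the
real-valued distance to `∅` is `0`, this fails for `M = ∅` when `0 < τ`. -/
def HasUniqueNearest (M : Set H) (τ : ℝ) : Prop :=
  ∀ q : H, infDist q M < τ → ∃ z ∈ M, ‖q - z‖ = infDist q M ∧
    ∀ y ∈ M, ‖q - y‖ = infDist q M → y = z

theorem infDist_le_norm_sub {M : Set H} {q y : H} (hy : y ∈ M) : infDist q M ≤ ‖q - y‖ := by
  rw [← dist_eq_norm]; exact infDist_le_dist_of_mem hy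

theorem infDist_le_infDist_add_norm {M : Set H} (q q' : H) :
    infDist q M ≤ infDist q' M + ‖q - q'‖ := by
  rw [← dist_eq_norm]; exact infDist_le_infDist_add_dist

/-- The nearest point map is continuous at `q` as long as nearest points of nearby points stay in
a compact set. -/
theorem exists_nearest_close {M K : Set H} (hK : IsCompact K) (hKM : K ⊆ M) {q z : H}
    (hz : ∀ y ∈ M, ‖q - y‖ = infDist q M → y = z) {ε : ℝ} (hε : 0 < ε) :
    ∃ δ > 0, ∀ q', ‖q' - q‖ < δ → ∀ z' ∈ K, ‖q' - z'‖ = infDist q' M → ‖z' - z‖ < ε := by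
  have hK' : IsCompact (K \ ball z ε) := hK.diff isOpen_ball
  rcases (K \ ball z ε).eq_empty_or_nonempty with he | hne
  · refine ⟨1, one_pos, fun q' _ z' hz' _ => ?_⟩
    by_contra! h
    have : z' ∈ K \ ball z ε := ⟨hz', by simpa [dist_eq_norm] using h⟩
    simp [he] at this
  · obtain ⟨y₀, hy₀, hmin⟩ := hK'.exists_isMinOn hne
      (show ContinuousOn (fun y => ‖q - y‖) (K \ ball z ε) by fun_prop)
    have hgap : infDist q M < ‖q - y₀‖ := by
      refine lt_of_le_of_ne (infDist_le_norm_sub (hKM hy₀.1)) fun h => ?_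
      have := hz y₀ (hKM hy₀.1) h.symm
      exact hy₀.2 (by simp [this, hε])
    refine ⟨(‖q - y₀‖ - infDist q M) / 2, by linarith, fun q' hq' z' hz' hzd => ?_⟩
    by_contra! h
    have h1 : ‖q - y₀‖ ≤ ‖q - z'‖ := hmin ⟨hz', by simpa [dist_eq_norm] using h⟩
    have h2 : ‖q - z'‖ ≤ ‖q - q'‖ + ‖q' - z'‖ := norm_sub_le_norm_sub_add_norm_sub _ _ _
    have h3 := infDist_le_infDist_add_norm (M := M) q' q
    rw [norm_sub_rev q q'] at h2
    linarith

variable [InnerProductSpace ℝ H]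

/-- The rolling ball condition at `p` with radius `R`: no point of `M` lies in an open ball of
radius `R` whose boundary passes through `p` with inner normal direction in `Tᗮ`. -/
def RollingBall (M : Set H) (p : H) (T : Submodule ℝ H) (R : ℝ) : Prop :=
  ∀ n ∈ Tᗮ, ∀ y ∈ M, ⟪n, y - p⟫ ≤ ‖n‖ * ‖y - p‖ ^ 2 / (2 * R)

/-- Where the nearest point map is continuous, moving away from the nearest point increases the
distance to `M` at a rate arbitrarily close to one. -/
theorem exists_ascent {M : Set H} {q z : H} (hz : ‖q - z‖ = infDist q M) (hpos : 0 < infDist q M)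
    {l : ℝ} (hl : 0 < l) (hl1 : l < 1) {δ : ℝ} (hδ : 0 < δ)
    (hnear : ∀ ε > 0, ∃ δ > 0, ∀ q', ‖q' - q‖ < δ →
      ∃ z' ∈ M, ‖q' - z'‖ = infDist q' M ∧ ‖z' - z‖ < ε) :
    ∃ q', ‖q' - q‖ < δ ∧ q' ≠ q ∧ l * ‖q' - q‖ ≤ infDist q' M - infDist q M := by
  set r := infDist q M with hr
  obtain ⟨δ', hδ', hd⟩ := hnear ((1 - l) * r) (mul_pos (by linarith) hpos)
  set h := min δ δ' / 2 with hh
  have hmin : 0 < min δ δ' := lt_min hδ hδ'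
  have hh0 : 0 < h := by positivity
  have hhδ : h < δ := by have := min_le_left δ δ'; linarith
  have hhδ' : h < δ' := by have := min_le_right δ δ'; linarith
  set e := r⁻¹ • (q - z) with he
  have hen : ‖e‖ = 1 := by
    rw [he, norm_smul, hz, Real.norm_of_nonneg (by positivity), inv_mul_cancel₀ hpos.ne']
  have hqe : ‖(q + h • e) - q‖ = h := by
    rw [add_sub_cancel_left, norm_smul, hen, Real.norm_of_nonneg hh0.le, mul_one]
  obtain ⟨z', hz'M, hz', hzz⟩ := hd (q + h • e) (by rwa [hqe])
  refine ⟨q + h • e, by rwa [hqe], fun hc => ?_, ?_⟩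
  · rw [hc, sub_self, norm_zero] at hqe; exact hh0.ne hqe
  rw [hqe]
  by_contra! hcon
  have h1 : r ≤ ‖q - z'‖ := infDist_le_norm_sub hz'M
  have h2 : infDist (q + h • e) M ^ 2 = ‖q - z'‖ ^ 2 + 2 * h * ⟪q - z', e⟫ + h ^ 2 := by
    rw [← hz', show q + h • e - z' = (q - z') + h • e by abel, norm_add_sq_real, norm_smul, hen,
      inner_smul_right, Real.norm_of_nonneg hh0.le]
    ring
  have h3 : ⟪q - z', e⟫ = r - ⟪z' - z, e⟫ := by
    have : ⟪q - z, e⟫ = r := by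
      rw [he, inner_smul_right, real_inner_self_eq_norm_sq, hz, pow_two, ← mul_assoc,
        inv_mul_cancel₀ hpos.ne', one_mul]
    rw [← this, ← inner_sub_left]; congr 1; abel
  have h4 : ⟪z' - z, e⟫ ≤ (1 - l) * r := by
    have := real_inner_le_norm (z' - z) e
    rw [hen, mul_one] at this
    linarith
  have h5 : infDist (q + h • e) M < r + l * h := by linarith
  have h6 : infDist (q + h • e) M ^ 2 < (r + l * h) ^ 2 := by
    gcongr; exact infDist_nonneg
  have h7 : r ^ 2 ≤ ‖q - z'‖ ^ 2 := by gcongr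
  have h8 : l * r ≤ ⟪q - z', e⟫ := by linarith
  have h9 : h * (l * r) ≤ h * ⟪q - z', e⟫ := by gcongr
  have h10 : (l * h) ^ 2 ≤ h ^ 2 := by
    have : l * h ≤ h := by nlinarith
    gcongr
  nlinarith

variable [CompleteSpace H]

/-- If a normal ray realizes the distance to `M` at time `s < R`, it does so a little longer. -/
theorem exists_extension {M : Set H} {τ R s : ℝ} (hM : HasUniqueNearest M τ) {p n : H} (hp : p ∈ M)
    (hn : ‖n‖ = 1) (hRτ : R ≤ τ) (hK : IsCompact (M ∩ closedBall p (2 * R)))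
    (hs : 0 < s) (hsR : s < R) (hsd : s ≤ infDist (p + s • n) M) :
    ∃ η > 0, s + η ≤ infDist (p + (s + η) • n) M := by
  obtain ⟨η, hη, hηs, hηR⟩ : ∃ η > 0, η < s ∧ s + η < R := by
    refine ⟨min s (R - s) / 2, ?_, ?_, ?_⟩
    · have : 0 < min s (R - s) := lt_min hs (by linarith)
      positivity
    · have := min_le_left s (R - s); linarith
    · have := min_le_right s (R - s); linarith
  refine ⟨η, hη, ?_⟩
  set q := p + s • n with hq
  have hqp : ‖q - p‖ = s := by
    rw [hq, add_sub_cancel_left, norm_smul, hn, Real.norm_of_nonneg hs.le, mul_one]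
  have hqd : infDist q M = s := le_antisymm (hqp ▸ infDist_le_norm_sub hp) hsd
  have hnearK : ∀ q', ‖q' - q‖ ≤ η → ∃ z' ∈ M ∩ closedBall p (2 * R), ‖q' - z'‖ = infDist q' M ∧
      ∀ y ∈ M, ‖q' - y‖ = infDist q' M → y = z' := by
    intro q' hq'
    have h1 := infDist_le_infDist_add_norm (M := M) q' q
    obtain ⟨z', hz'M, hz', hu⟩ := hM q' (by linarith)
    refine ⟨z', ⟨hz'M, ?_⟩, hz', hu⟩
    rw [mem_closedBall, dist_eq_norm]
    have h2 : ‖z' - p‖ ≤ ‖z' - q'‖ + ‖q' - p‖ := norm_sub_le_norm_sub_add_norm_sub _ _ _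
    have h3 : ‖q' - p‖ ≤ ‖q' - q‖ + ‖q - p‖ := norm_sub_le_norm_sub_add_norm_sub _ _ _
    rw [norm_sub_rev z' q'] at h2
    linarith
  -- steepest ascent from `q` reaches the sphere of radius `η` with an almost optimal gain
  have hex : ∀ l : ℝ, 0 < l → l < 1 → ∃ x, ‖x - q‖ = η ∧ s + l * η ≤ infDist x M := by
    intro l hl hl1
    have hb : BddAbove ((fun x => infDist x M) '' closedBall q η) := by
      refine ⟨s + η, ?_⟩
      rintro _ ⟨x, hx, rfl⟩
      have := infDist_le_infDist_add_norm (M := M) x q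
      rw [mem_closedBall, dist_eq_norm] at hx
      simp only; linarith
    obtain ⟨x, hx, hx1, hx2⟩ := exists_ascent_maximal (isClosed_closedBall (x := q) (ε := η))
      (continuous_infDist_pt M) hb hl (mem_closedBall_self hη.le)
    rw [mem_closedBall, dist_eq_norm] at hx
    rw [dist_comm, dist_eq_norm, hqd] at hx1
    have hxη : ‖x - q‖ = η := by
      by_contra hne
      have hlt : ‖x - q‖ < η := lt_of_le_of_ne hx hne
      obtain ⟨z, hz, hzd, hzu⟩ := hnearK x hx
      have hxpos : 0 < infDist x M := by
        have := infDist_le_infDist_add_norm (M := M) q x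
        rw [norm_sub_rev q x] at this
        linarith
      obtain ⟨x', hx'1, hx'2, hx'3⟩ := exists_ascent hzd hxpos hl hl1
        (show 0 < η - ‖x - q‖ by linarith) (fun ε hε => by
          obtain ⟨δ, hδ, hδ'⟩ := exists_nearest_close hK inter_subset_left hzu hε
          refine ⟨min δ (η - ‖x - q‖), lt_min hδ (by linarith), fun q' hq' => ?_⟩
          have h1 := hq'.trans_le (min_le_left _ _)
          have h2 := hq'.trans_le (min_le_right _ _)
          have h3 : ‖q' - q‖ ≤ ‖q' - x‖ + ‖x - q‖ := norm_sub_le_norm_sub_add_norm_sub _ _ _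
          obtain ⟨z', hz', hzd', -⟩ := hnearK q' (by linarith)
          exact ⟨z', hz'.1, hzd', hδ' q' h1 z' hz' hzd'⟩)
      have h3 : ‖x' - q‖ ≤ ‖x' - x‖ + ‖x - q‖ := norm_sub_le_norm_sub_add_norm_sub _ _ _
      exact hx'2 (hx2 x' (by rw [mem_closedBall, dist_eq_norm]; linarith)
        (by rwa [dist_comm, dist_eq_norm]))
    exact ⟨x, hxη, by rw [hxη] at hx1; linarith⟩
  -- a point at distance `η` from `q` and nearly `s + η` from `p` is close to the ray
  have hbound : ∀ l : ℝ, 0 < l → l < 1 →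
      s + l * η - √(2 * η ^ 2 * (1 - l) + (1 - l ^ 2) * η ^ 3 / s) ≤
        infDist (p + (s + η) • n) M := by
    intro l hl hl1
    obtain ⟨x, hxη, hxd⟩ := hex l hl hl1
    set w := x - q with hw
    have h1 : s + l * η ≤ ‖s • n + w‖ := by
      have := infDist_le_norm_sub (q := x) hp
      rw [show x - p = s • n + w by rw [hw, hq]; abel] at this
      linarith
    have h2 : (s + l * η) ^ 2 ≤ s ^ 2 + 2 * s * ⟪n, w⟫ + η ^ 2 := by
      have h3 : (s + l * η) ^ 2 ≤ ‖s • n + w‖ ^ 2 := by gcongr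
      rw [norm_add_sq_real, norm_smul, hn, hxη, inner_smul_left, Real.norm_of_nonneg hs.le] at h3
      simp at h3
      linarith
    have h3 : ‖w - η • n‖ ^ 2 ≤ 2 * η ^ 2 * (1 - l) + (1 - l ^ 2) * η ^ 3 / s := by
      have h4 : ‖w - η • n‖ ^ 2 = 2 * η ^ 2 - 2 * η * ⟪n, w⟫ := by
        rw [norm_sub_sq_real, norm_smul, hn, hxη, inner_smul_right, Real.norm_of_nonneg hη.le,
          real_inner_comm]
        ring
      have h5 : 2 * η ^ 2 * (1 - l) + (1 - l ^ 2) * η ^ 3 / s - ‖w - η • n‖ ^ 2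
          = η / s * (s ^ 2 + 2 * s * ⟪n, w⟫ + η ^ 2 - (s + l * η) ^ 2) := by
        rw [h4]; field_simp; ring
      have h6 : 0 ≤ η / s * (s ^ 2 + 2 * s * ⟪n, w⟫ + η ^ 2 - (s + l * η) ^ 2) :=
        mul_nonneg (by positivity) (by linarith)
      linarith
    have h4 := Real.le_sqrt_of_sq_le h3
    have h5 := infDist_le_infDist_add_norm (M := M) x (p + (s + η) • n)
    rw [show x - (p + (s + η) • n) = w - η • n by rw [hw, hq, add_smul]; abel] at h5
    linarith
  have hcont : ContinuousAt
      (fun l : ℝ => s + l * η - √(2 * η ^ 2 * (1 - l) + (1 - l ^ 2) * η ^ 3 / s)) 1 := by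
    fun_prop
  have hlim := hcont.tendsto.mono_left (nhdsWithin_le_nhds (s := Iio 1))
  simp only [one_mul, sub_self, mul_zero, one_pow, zero_mul, zero_div, add_zero, Real.sqrt_zero,
    sub_zero] at hlim
  refine le_of_tendsto hlim ?_
  filter_upwards [Ioo_mem_nhdsLT (show (0 : ℝ) < 1 by norm_num)] with l hl
  exact hbound l hl.1 hl.2

/-- Unique nearest points within distance `R` force the rolling ball condition of radius `R` at `p`,
provided `M` is compact near `p`. -/
theorem IsTangentParam.rollingBall {M : Set H} {τ R : ℝ} (hM : HasUniqueNearest M τ) {p : H}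
    (hp : p ∈ M) {T : Submodule ℝ H} {g : H → H} (hT : IsTangentParam M p T g) (hR : 0 < R)
    (hRτ : R ≤ τ) (hK : IsCompact (M ∩ closedBall p (2 * R))) : RollingBall M p T R := by
  -- it suffices to treat unit normals
  suffices hunit : ∀ n ∈ Tᗮ, ‖n‖ = 1 → ∀ y ∈ M, ⟪n, y - p⟫ ≤ ‖y - p‖ ^ 2 / (2 * R) by
    intro n hn y hy
    rcases eq_or_ne n 0 with rfl | hn0
    · simp
    have hn1 : 0 < ‖n‖ := norm_pos_iff.2 hn0
    have := hunit (‖n‖⁻¹ • n) (Submodule.smul_mem _ _ hn) (norm_smul_inv_norm hn0) y hy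
    rw [inner_smul_left, RCLike.conj_to_real, inv_mul_le_iff₀ hn1] at this
    rwa [mul_div_assoc]
  intro n hn hn1 y hy
  -- near `p` by the quadratic estimate, far from `p` by the triangle inequality
  have hstart : ∃ t₀ > 0, t₀ ≤ infDist (p + t₀ • n) M := by
    obtain ⟨K, hK0, hq⟩ := hT.exists_quadratic
    obtain ⟨r, hr, hball⟩ := Metric.eventually_nhds_iff_ball.1 hq
    refine ⟨min (r / 2) (1 / (2 * K + 1)), lt_min (by positivity) (by positivity), ?_⟩
    set t := min (r / 2) (1 / (2 * K + 1)) with ht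
    have ht0 : 0 < t := lt_min (by positivity) (by positivity)
    have ht1 : t ≤ r / 2 := min_le_left _ _
    have ht2 : t * (2 * K + 1) ≤ 1 := by
      rw [← le_div_iff₀ (by positivity)]; exact min_le_right _ _
    rw [le_infDist ⟨p, hp⟩]
    intro m hm
    rw [dist_eq_norm, show p + t • n - m = t • n - (m - p) by abel]
    have htn : ‖t • n‖ = t := by rw [norm_smul, hn1, Real.norm_of_nonneg ht0.le, mul_one]
    by_cases hmr : ‖m - p‖ < r
    · obtain ⟨w, hw, hmw⟩ := hball m (by rwa [mem_ball, dist_eq_norm]) hm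
      have h1 : ⟪n, m - p⟫ ≤ K * ‖m - p‖ ^ 2 := by
        have h2 : ⟪n, m - p⟫ = ⟪n, m - p - w⟫ := by
          rw [inner_sub_right n (m - p) w, (Submodule.mem_orthogonal' _ _).1 hn w hw, sub_zero]
        rw [h2]
        refine (real_inner_le_norm _ _).trans ?_
        rw [hn1, one_mul]; exact hmw
      refine le_of_sq_le_sq ?_ (norm_nonneg _)
      rw [norm_sub_sq_real, htn, inner_smul_left, RCLike.conj_to_real]
      nlinarith [sq_nonneg ‖m - p‖]
    · have := norm_sub_norm_le (m - p) (t • n)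
      rw [norm_sub_rev (m - p), htn] at this
      linarith
  obtain ⟨t₀, ht₀, ht₀d⟩ := hstart
  -- the property propagates downwards because the distance is `1`-Lipschitz
  have hdown : ∀ {t t'}, t ≤ t' → t' ≤ infDist (p + t' • n) M → t ≤ infDist (p + t • n) M := by
    intro t t' htt' h
    have := infDist_le_infDist_add_norm (M := M) (p + t' • n) (p + t • n)
    rw [show p + t' • n - (p + t • n) = (t' - t) • n by rw [sub_smul]; abel, norm_smul, hn1,
      Real.norm_of_nonneg (by linarith)] at this
    linarith
  have hall : R ≤ infDist (p + R • n) M := by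
    rcases le_or_gt R t₀ with h | h
    · exact hdown h ht₀d
    have hcl : IsClosed ({t : ℝ | t ≤ infDist (p + t • n) M} ∩ Icc t₀ R) := by
      refine IsClosed.inter (isClosed_le continuous_id ?_) isClosed_Icc
      exact (continuous_infDist_pt M).comp (by fun_prop)
    refine hcl.Icc_subset_of_forall_exists_gt ht₀d (fun t ht y hy => ?_) (right_mem_Icc.2 h.le)
    obtain ⟨η, hη, hηd⟩ := exists_extension hM hp hn1 hRτ hK (ht₀.trans_le ht.2.1) ht.2.2 ht.1
    have hy : t < y := hy
    refine ⟨min (t + η) y, hdown (min_le_left _ _) hηd, lt_min (by linarith) hy, min_le_right _ _⟩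
  have h1 : R ≤ ‖R • n - (y - p)‖ := by
    have := hall.trans (infDist_le_norm_sub hy)
    rwa [show p + R • n - y = R • n - (y - p) by abel] at this
  have h2 : R ^ 2 ≤ ‖R • n - (y - p)‖ ^ 2 := by gcongr
  rw [norm_sub_sq_real, norm_smul, hn1, inner_smul_left, RCLike.conj_to_real,
    Real.norm_of_nonneg hR.le] at h2
  rw [le_div_iff₀ (by positivity)]
  linarith

end Nearest

/-! ### Second order contact with the tangent space -/

section TangentReach

variable {H : Type*} [NormedAddCommGroup H] [InnerProductSpace ℝ H]

/-- A rolling ball condition that holds uniformly at the points of `M` near `p`, together with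
the existence of nearest points. -/
structure UniformRollingBall (M : Set H) (p : H) (R : ℝ) : Prop where
  rolling : ∀ z ∈ M, ‖z - p‖ ≤ 2 * R → ∃ T g, IsTangentParam M z T g ∧ RollingBall M z T R
  nearest : ∀ q, ‖q - p‖ < R → ∃ z ∈ M, ‖q - z‖ = infDist q M

/-- The norm lies below its second order expansion in the direction of a unit vector. -/
theorem norm_add_smul_le {u v : H} (hu : 0 < ‖u‖) (hv : ‖v‖ = 1) (h : ℝ) :
    ‖u + h • v‖ ≤ ‖u‖ + h * (⟪u, v⟫ / ‖u‖) + h ^ 2 / (2 * ‖u‖) := by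
  set x := h * (⟪u, v⟫ / ‖u‖) + h ^ 2 / (2 * ‖u‖) with hx
  have h1 : ‖u + h • v‖ ^ 2 = ‖u‖ ^ 2 + 2 * ‖u‖ * x := by
    rw [norm_add_sq_real, norm_smul, hv, inner_smul_right, hx, mul_one, Real.norm_eq_abs, sq_abs]
    field_simp
    ring
  have h2 : 0 ≤ ‖u‖ + x := by nlinarith [sq_nonneg ‖u + h • v‖]
  rw [add_assoc, ← hx]
  refine le_of_sq_le_sq ?_ h2
  nlinarith [sq_nonneg x]

/-- The derivative of the distance to `M` along a ray `t ↦ p + t • v` exceeds the distance divided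
by `t` by at most `2 * t / R`. -/
theorem UniformRollingBall.inner_le {M : Set H} {p : H} {R : ℝ} (hU : UniformRollingBall M p R)
    (hp : p ∈ M) (hR : 0 < R) {v z : H} (hv : ‖v‖ = 1) {t : ℝ} (ht : 0 < t) (htR : t < R)
    (hz : z ∈ M) (hzd : ‖p + t • v - z‖ = infDist (p + t • v) M) :
    ⟪p + t • v - z, v⟫ ≤ ‖p + t • v - z‖ * (‖p + t • v - z‖ / t + 2 * t / R) := by
  set q := p + t • v with hq
  have hqp : ‖q - p‖ = t := by
    rw [hq, add_sub_cancel_left, norm_smul, hv, Real.norm_of_nonneg ht.le, mul_one]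
  have h1 : ‖q - z‖ ≤ t := by rw [hzd, ← hqp]; exact infDist_le_norm_sub hp
  have h2 : ‖z - p‖ ≤ 2 * t := by
    have := norm_sub_le_norm_sub_add_norm_sub z q p
    rw [norm_sub_rev z q] at this
    linarith
  obtain ⟨T, g, hT, hroll⟩ := hU.rolling z hz (by linarith)
  have hu : q - z ∈ Tᗮ := hT.sub_mem_orthogonal fun y hy => by
    rw [hzd]; exact infDist_le_norm_sub hy
  -- the negative of a normal vector is normal, which bounds the inner product from below
  have h3 := hroll (-(q - z)) (Submodule.neg_mem _ hu) p hp
  rw [norm_neg, norm_sub_rev p z] at h3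
  have h4 : ‖q - z‖ * ‖z - p‖ ^ 2 / (2 * R) ≤ ‖q - z‖ * (2 * t ^ 2 / R) := by
    rw [mul_div_assoc]
    refine mul_le_mul_of_nonneg_left ?_ (norm_nonneg _)
    rw [div_le_div_iff₀ (by positivity) hR]
    have : ‖z - p‖ ^ 2 ≤ (2 * t) ^ 2 := by gcongr
    nlinarith
  have h5 : t * ⟪q - z, v⟫ = ‖q - z‖ ^ 2 + ⟪-(q - z), p - z⟫ := by
    rw [← real_inner_self_eq_norm_sq, inner_neg_left, ← sub_eq_add_neg, ← inner_sub_right,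
      ← real_inner_smul_right]
    congr 1
    rw [hq]; abel
  have h6 : ‖q - z‖ * (‖q - z‖ / t + 2 * t / R)
      = (‖q - z‖ ^ 2 + ‖q - z‖ * (2 * t ^ 2 / R)) / t := by field_simp
  rw [h6, le_div_iff₀ ht]
  linarith

/-- Moving along the tangent space at `p`, the manifold is left only to second order. -/
theorem UniformRollingBall.exists_near {M : Set H} {p : H} {R : ℝ} (hU : UniformRollingBall M p R)
    (hp : p ∈ M) (hR : 0 < R) {T : Submodule ℝ H} {g : H → H} (hT : IsTangentParam M p T g)
    {v : H} (hvT : v ∈ T) (hv : ‖v‖ = 1) {s : ℝ} (hs : 0 < s) (hsR : s < R) :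
    ∃ a ∈ M, ‖a - (p + s • v)‖ ≤ 2 * s ^ 2 / R := by
  set G : ℝ → ℝ := fun t => infDist (p + t • v) M with hG
  have hGc : Continuous G := (continuous_infDist_pt M).comp (by fun_prop)
  suffices hmain : ∀ η > 0, G s ≤ s * (η + (2 + η) * s / R) by
    obtain ⟨a, ha, had⟩ := hU.nearest (p + s • v) (by
      rwa [add_sub_cancel_left, norm_smul, hv, Real.norm_of_nonneg hs.le, mul_one])
    refine ⟨a, ha, ?_⟩
    rw [norm_sub_rev, had]
    have hlim : Tendsto (fun η : ℝ => s * (η + (2 + η) * s / R)) (𝓝[>] 0)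
        (𝓝 (s * (0 + (2 + 0) * s / R))) := by
      have : Continuous (fun η : ℝ => s * (η + (2 + η) * s / R)) := by fun_prop
      exact (this.tendsto 0).mono_left nhdsWithin_le_nhds
    have := ge_of_tendsto hlim (eventually_nhdsWithin_of_forall fun η hη => hmain η hη)
    refine this.trans (le_of_eq ?_)
    ring
  intro η hη
  obtain ⟨a, ⟨m, hm, hma⟩, ha0, has⟩ := ((hT.eventually_norm_sub_le hvT hη).and
    (Ioo_mem_nhdsGT hs)).exists
  -- a strict supersolution of `G' ≤ G / t + 2 * t / R` with `G ≤ B` for small times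
  set B : ℝ → ℝ := fun t => t * (η + (2 + η) * t / R) with hB
  have hBd : ∀ t, HasDerivAt B (η + 2 * (2 + η) * t / R) t := by
    intro t
    have h1 : HasDerivAt (fun t : ℝ => η + (2 + η) * t / R) ((2 + η) / R) t := by
      have := (((hasDerivAt_id t).const_mul (2 + η)).div_const R).const_add η
      simpa using this
    exact ((hasDerivAt_id' t).mul h1).congr_deriv (by ring)
  -- where `G` vanishes, only the Lipschitz bound is available; there `G < B`, so it is not used
  set f' : ℝ → ℝ := fun t => if G t = 0 then 1 else G t / t + 2 * t / R with hf'
  refine image_le_of_liminf_slope_right_lt_deriv_boundary (f := G) (f' := f') (a := a) (b := s)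
    (B := B) hGc.continuousOn ?_ ?_ hBd ?_ (right_mem_Icc.2 has.le)
  · intro t ht r hr
    refine Eventually.frequently ?_
    have ht0 : 0 < t := ha0.trans_le ht.1
    by_cases h0 : G t = 0
    · simp only [hf', h0, if_true] at hr
      filter_upwards [self_mem_nhdsWithin] with x hx
      have hx : t < x := hx
      rw [slope_def_field, div_lt_iff₀ (by linarith)]
      have := infDist_le_infDist_add_norm (M := M) (p + x • v) (p + t • v)
      rw [show p + x • v - (p + t • v) = (x - t) • v by rw [sub_smul]; abel, norm_smul, hv,
        Real.norm_of_nonneg (by linarith)] at this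
      simp only [hG]
      nlinarith
    · simp only [hf', h0, if_false] at hr
      obtain ⟨z, hz, hzd⟩ := hU.nearest (p + t • v) (by
        rw [add_sub_cancel_left, norm_smul, hv, Real.norm_of_nonneg ht0.le, mul_one]
        exact ht.2.trans hsR)
      have hGt : G t = ‖p + t • v - z‖ := hzd.symm
      have hpos : 0 < ‖p + t • v - z‖ := by
        rw [← hGt]; exact lt_of_le_of_ne infDist_nonneg (Ne.symm h0)
      have hin := hU.inner_le hp hR hv ht0 (ht.2.trans hsR) hz hzd
      set u := p + t • v - z with hu
      rw [hGt] at hr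
      have hin' : ⟪u, v⟫ / ‖u‖ < r := lt_of_le_of_lt (by rwa [div_le_iff₀' hpos]) hr
      have hlim : Tendsto (fun x : ℝ => ⟪u, v⟫ / ‖u‖ + (x - t) / (2 * ‖u‖)) (𝓝[>] t)
          (𝓝 (⟪u, v⟫ / ‖u‖ + (t - t) / (2 * ‖u‖))) := by
        have : Continuous (fun x : ℝ => ⟪u, v⟫ / ‖u‖ + (x - t) / (2 * ‖u‖)) := by fun_prop
        exact (this.tendsto t).mono_left nhdsWithin_le_nhds
      filter_upwards [hlim.eventually_lt_const (show _ < r by simpa using hin'),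
        self_mem_nhdsWithin] with x hx hxt
      have hxt : t < x := hxt
      rw [slope_def_field, div_lt_iff₀ (by linarith)]
      have h1 : G x ≤ ‖u + (x - t) • v‖ := by
        have := infDist_le_norm_sub (q := p + x • v) hz
        rwa [show p + x • v - z = u + (x - t) • v by rw [hu, sub_smul]; abel] at this
      have h2 := norm_add_smul_le hpos hv (x - t)
      rw [hGt]
      have h3 : (⟪u, v⟫ / ‖u‖ + (x - t) / (2 * ‖u‖)) * (x - t) < r * (x - t) :=
        mul_lt_mul_of_pos_right hx (by linarith)
      have h4 : (⟪u, v⟫ / ‖u‖ + (x - t) / (2 * ‖u‖)) * (x - t)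
          = (x - t) * (⟪u, v⟫ / ‖u‖) + (x - t) ^ 2 / (2 * ‖u‖) := by ring
      linarith
  · have h1 : G a ≤ η * a := (infDist_le_norm_sub hm).trans hma
    have h2 : η * a ≤ B a := by
      have : 0 ≤ a * ((2 + η) * a / R) := by positivity
      simp only [hB]; linarith
    exact h1.trans h2
  · intro t ht hGB
    have ht0 : 0 < t := ha0.trans_le ht.1
    have hBpos : 0 < B t := by simp only [hB]; positivity
    simp only [hf', hGB, hBpos.ne', if_false]
    have h1 : B t / t = η + (2 + η) * t / R := by
      simp only [hB]; rw [mul_div_cancel_left₀ _ ht0.ne']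
    rw [h1]
    have h2 : 2 * (2 + η) * t / R = (2 + η) * t / R + 2 * t / R + η * t / R := by ring
    have h3 : 0 < η * t / R := by positivity
    linarith

end TangentReach

/-! ### Lower volume bounds and compactness -/

section Volume

variable {H : Type*} [NormedAddCommGroup H] [InnerProductSpace ℝ H]

theorem RollingBall.norm_sub_starProjection_le {M : Set H} {p : H} {T : Submodule ℝ H}
    [T.HasOrthogonalProjection] {R : ℝ} (h : RollingBall M p T R) {y : H} (hy : y ∈ M) (hR : 0 < R) :
    ‖y - p - T.starProjection (y - p)‖ ≤ ‖y - p‖ ^ 2 / (2 * R) := by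
  set n := y - p - T.starProjection (y - p) with hn
  have hnT : n ∈ Tᗮ := Submodule.sub_starProjection_mem_orthogonal _
  have h1 := h n hnT y hy
  have h2 : ⟪n, y - p⟫ = ‖n‖ ^ 2 := by
    have h3 : ⟪n, T.starProjection (y - p)⟫ = 0 :=
      (Submodule.mem_orthogonal' _ _).1 hnT _ (Submodule.starProjection_apply_mem _ _)
    rw [← real_inner_self_eq_norm_sq]
    conv_rhs => rw [hn, inner_sub_right, ← hn, h3, sub_zero]
  rw [h2, pow_two, mul_div_assoc] at h1
  rcases eq_or_lt_of_le (norm_nonneg n) with h0 | h0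
  · rw [← h0]; positivity
  · exact le_of_mul_le_mul_left h1 h0

/-- The orthogonal projection of `M` near `p` onto the tangent space covers a ball. -/
theorem UniformRollingBall.exists_starProjection_eq {M : Set H} {p : H} {R : ℝ}
    (hU : UniformRollingBall M p R) (hp : p ∈ M) (hR : 0 < R) {T : Submodule ℝ H}
    [T.HasOrthogonalProjection] {g : H → H} (hT : IsTangentParam M p T g)
    (hroll : RollingBall M p T R) (hK : IsCompact (M ∩ closedBall p (R / 8))) {w : H} (hw : w ∈ T)
    (hwR : ‖w‖ ≤ R / 32) :
    ∃ z ∈ M ∩ closedBall p (R / 8), T.starProjection (z - p) = w := by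
  set f : H → ℝ := fun z => ‖T.starProjection (z - p) - w‖ ^ 2 with hf
  have hfc : Continuous f := by fun_prop
  obtain ⟨z, hz, hmin⟩ := hK.exists_isMinOn ⟨p, hp, mem_closedBall_self (by positivity)⟩
    hfc.continuousOn
  refine ⟨z, hz, ?_⟩
  set e := T.starProjection (z - p) - w with he
  have heT : e ∈ T := T.sub_mem (Submodule.starProjection_apply_mem _ _) hw
  have hzr : ‖z - p‖ ≤ R / 8 := by simpa [dist_eq_norm] using hz.2
  have hew : ‖e‖ ≤ ‖w‖ := by
    have : f z ≤ f p := hmin ⟨hp, mem_closedBall_self (by positivity)⟩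
    simp only [hf, sub_self, map_zero, zero_sub, norm_neg] at this
    exact le_of_sq_le_sq this (norm_nonneg _)
  have hzlt : ‖z - p‖ < R / 8 := by
    have h1 : ‖T.starProjection (z - p)‖ ≤ R / 16 := by
      have := norm_add_le e w
      rw [he, sub_add_cancel, ← he] at this
      linarith
    have h2 := hroll.norm_sub_starProjection_le hz.1 hR
    have h3 : ‖z - p‖ ^ 2 / (2 * R) ≤ R / 128 := by
      rw [div_le_div_iff₀ (by positivity) (by norm_num)]
      nlinarith [norm_nonneg (z - p)]
    have h4 := norm_add_le (T.starProjection (z - p)) (z - p - T.starProjection (z - p))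
    rw [add_sub_cancel] at h4
    linarith
  obtain ⟨T', g', hT', hroll'⟩ := hU.rolling z hz.1 (by linarith)
  -- at an interior minimum the residual is normal to `M`
  have heT' : e ∈ T'ᗮ := by
    rw [Submodule.mem_orthogonal']
    intro v hv
    have hloc : IsLocalMinOn f M z := by
      have hnhds : closedBall p (R / 8) ∈ 𝓝 z :=
        mem_of_superset (isOpen_ball.mem_nhds (by simpa [dist_eq_norm] using hzlt))
          ball_subset_closedBall
      have : 𝓝[M] z = 𝓝[M ∩ closedBall p (R / 8)] z := (nhdsWithin_inter_of_mem'
        (mem_nhdsWithin_of_mem_nhds hnhds)).symm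
      rw [IsLocalMinOn, IsMinFilter, this]
      exact hmin.filter_mono inf_le_right
    have hd : HasFDerivAt f (2 • (innerSL ℝ e).comp (T.starProjection : H →L[ℝ] H)) z := by
      have h1 : HasFDerivAt (fun z => T.starProjection (z - p) - w) T.starProjection z := by
        have h2 : HasFDerivAt (fun z : H => z - p) (ContinuousLinearMap.id ℝ H) z :=
          (hasFDerivAt_id z).sub_const p
        simpa using ((T.starProjection.hasFDerivAt (x := z - p)).comp z h2).sub_const w
      exact h1.norm_sq
    have h3 := hT'.fderiv_eq_zero hloc hd hv
    have h4 : ⟪e, T.starProjection v⟫ = ⟪e, v⟫ := by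
      rw [← Submodule.inner_starProjection_left_eq_right,
        Submodule.starProjection_eq_self_iff.2 heT]
    simpa [h4] using h3
  by_contra hne
  have he0 : e ≠ 0 := fun h => hne (sub_eq_zero.1 h)
  set v := ‖e‖⁻¹ • e with hv
  have hv1 : ‖v‖ = 1 := norm_smul_inv_norm he0
  have hvT : v ∈ T := T.smul_mem _ heT
  have hvT' : v ∈ T'ᗮ := Submodule.smul_mem _ _ heT'
  -- a nonzero residual direction `v` is tangent at `p` and normal at the nearby point `z`: the
  -- displacement from `p` to the point `a` of `M` near `p + (R / 8) • v` contradicts rolling at `z`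
  obtain ⟨a, ha, had⟩ := hU.exists_near hp hR hT hvT hv1 (s := R / 8) (by positivity) (by linarith)
  have had' : ‖a - (p + (R / 8) • v)‖ ≤ R / 32 := had.trans (le_of_eq (by field_simp; norm_num))
  have h1 := hroll' v hvT' a ha
  have h2 := hroll' (-v) (Submodule.neg_mem _ hvT') p hp
  rw [norm_neg, hv1, one_mul] at h2
  rw [hv1, one_mul] at h1
  have h3 : ‖a - z‖ ≤ 9 * R / 32 := by
    have : a - z = (a - (p + (R / 8) • v)) + ((R / 8) • v - (z - p)) := by abel
    rw [this]
    refine (norm_add_le _ _).trans ?_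
    have h4 := norm_sub_le ((R / 8) • v) (z - p)
    rw [norm_smul, hv1, Real.norm_of_nonneg (by positivity)] at h4
    linarith
  have h4 : ‖a - z‖ ^ 2 / (2 * R) ≤ 81 * R / 2048 := by
    rw [div_le_div_iff₀ (by positivity) (by norm_num)]
    nlinarith [norm_nonneg (a - z)]
  have h5 : ‖p - z‖ ^ 2 / (2 * R) ≤ R / 128 := by
    rw [norm_sub_rev, div_le_div_iff₀ (by positivity) (by norm_num)]
    nlinarith [norm_nonneg (z - p)]
  have h6 : ⟪v, a - z⟫ + ⟪-v, p - z⟫ = R / 8 + ⟪v, a - (p + (R / 8) • v)⟫ := by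
    have h7 : ⟪v, (R / 8) • v⟫ = R / 8 := by
      rw [inner_smul_right, real_inner_self_eq_norm_sq, hv1]; ring
    rw [← sub_sub, inner_sub_right v (a - p), h7, inner_neg_left, ← sub_eq_add_neg,
      ← inner_sub_right]
    rw [show a - z - (p - z) = a - p by abel]
    ring
  have h7 : -(R / 32) ≤ ⟪v, a - (p + (R / 8) • v)⟫ := by
    have := abs_real_inner_le_norm v (a - (p + (R / 8) • v))
    rw [hv1, one_mul] at this
    have := (abs_le.1 (this.trans had')).1
    exact this
  linarith

theorem euclideanHausdorffMeasure_image_le {X Y : Type*} [MetricSpace X] [MeasurableSpace X]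
    [BorelSpace X] [MetricSpace Y] [MeasurableSpace Y] [BorelSpace Y] {f : X → Y}
    (hf : LipschitzWith 1 f) (d : ℕ) (s : Set X) : μHE[d] (f '' s) ≤ μHE[d] s := by
  simp only [Measure.euclideanHausdorffMeasure_def, Measure.smul_apply]
  have := hf.hausdorffMeasure_image_le (d := d) (by positivity) s
  simp only [ENNReal.coe_one, ENNReal.one_rpow, one_mul] at this
  gcongr

/-- The volume of `M` near `p` is bounded below by a constant depending on `d` and `R` only. -/
theorem UniformRollingBall.volume_le [MeasurableSpace H] [BorelSpace H] {M : Set H} {p : H}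
    {R : ℝ} (hU : UniformRollingBall M p R) (hp : p ∈ M) (hR : 0 < R) {T : Submodule ℝ H} {d : ℕ}
    (hTd : Module.rank ℝ T = d) {g : H → H} (hT : IsTangentParam M p T g)
    (hroll : RollingBall M p T R) (hK : IsCompact (M ∩ closedBall p (R / 8))) :
    volume (closedBall (0 : EuclideanSpace ℝ (Fin d)) (R / 32)) ≤
      μHE[d] (M ∩ closedBall p (R / 8)) := by
  have hfin : FiniteDimensional ℝ T := Module.finite_of_rank_eq_nat hTd
  have hfr : Module.finrank ℝ T = d := Module.finrank_eq_of_rank_eq hTd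
  let e : EuclideanSpace ℝ (Fin d) ≃ₗᵢ[ℝ] T :=
    ((stdOrthonormalBasis ℝ T).reindex (finCongr hfr)).repr.symm
  have hi : Isometry (fun x => ((e x : T) : H)) := isometry_subtype_coe.comp e.isometry
  have hsub : (fun x => ((e x : T) : H)) '' closedBall (0 : EuclideanSpace ℝ (Fin d)) (R / 32) ⊆
      (fun y => T.starProjection (y - p)) '' (M ∩ closedBall p (R / 8)) := by
    rintro _ ⟨x, hx, rfl⟩
    have hx' : ‖((e x : T) : H)‖ ≤ R / 32 := by
      rw [Submodule.norm_coe, e.norm_map]; simpa using hx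
    obtain ⟨z, hz, hzx⟩ := hU.exists_starProjection_eq hp hR hT hroll hK (e x).2 hx'
    exact ⟨z, hz, hzx⟩
  have hlip : LipschitzWith 1 (fun y => T.starProjection (y - p)) := by
    refine LipschitzWith.of_dist_le_mul fun x y => ?_
    rw [dist_eq_norm, ← map_sub, sub_sub_sub_cancel_right, NNReal.coe_one, one_mul, dist_eq_norm]
    exact T.norm_starProjection_apply_le _
  calc volume (closedBall (0 : EuclideanSpace ℝ (Fin d)) (R / 32))
      = μHE[d] (closedBall (0 : EuclideanSpace ℝ (Fin d)) (R / 32)) := by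
        rw [EuclideanSpace.euclideanHausdorffMeasure_eq_volume]
    _ = μHE[d] ((fun x => ((e x : T) : H)) ''
          closedBall (0 : EuclideanSpace ℝ (Fin d)) (R / 32)) :=
        (hi.euclideanHausdorffMeasure_image _).symm
    _ ≤ _ := measure_mono hsub
    _ ≤ _ := euclideanHausdorffMeasure_image_le hlip d _

variable [CompleteSpace H]

theorem uniformRollingBall_of_isCompact {d : ℕ} {M : Set H} {τ ρ : ℝ} (hM : IsSubmanifold 2 d M)
    (hu : HasUniqueNearest M τ) {p : H} (hp : p ∈ M) (hρ : 0 < ρ) (hρτ : ρ ≤ τ)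
    (hK : IsCompact (M ∩ closedBall p (4 * ρ))) : UniformRollingBall M p ρ where
  rolling z hz hzp := by
    obtain ⟨T, g, -, hT⟩ := hM.exists_isTangentParam hz
    refine ⟨T, g, hT, hT.rollingBall hu hz hρ hρτ ?_⟩
    refine hK.of_isClosed_subset (hM.1.inter isClosed_closedBall) ?_
    refine inter_subset_inter_right _ (closedBall_subset_closedBall' ?_)
    rw [dist_eq_norm]; linarith
  nearest q hq := by
    obtain ⟨z, hz, hzd, -⟩ := hu q (by have := infDist_le_norm_sub (q := q) hp; linarith)
    exact ⟨z, hz, hzd⟩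

/-- Each compact piece of `M` of a fixed size carries a definite amount of volume, so finitely many
of them suffice. -/
theorem isCompact_inter_closedBall [MeasurableSpace H] [BorelSpace H] {d : ℕ} {M : Set H} {τ : ℝ}
    (hM : IsSubmanifold 2 d M) (hu : HasUniqueNearest M τ) (hvol : μHE[d] M ≠ ∞) {p : H} {r ρ : ℝ}
    (hρ : 0 < ρ) (hρτ : ρ ≤ τ)
    (hK : ∀ q ∈ M ∩ closedBall p r, IsCompact (M ∩ closedBall q (4 * ρ))) :
    IsCompact (M ∩ closedBall p r) := by
  obtain ⟨u, huX, hdisj, hcov⟩ := Vitali.exists_disjoint_subfamily_covering_enlargement_closedBall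
    (M ∩ closedBall p r) id (fun _ => ρ / 8) (ρ / 8) (fun _ _ => le_rfl) 5 (by norm_num)
  have hvolle : ∀ q ∈ M ∩ closedBall p r,
      volume (closedBall (0 : EuclideanSpace ℝ (Fin d)) (ρ / 32)) ≤
        μHE[d] (M ∩ closedBall q (ρ / 8)) := by
    intro q hq
    have hKs : ∀ ρ' ≤ 4 * ρ, IsCompact (M ∩ closedBall q ρ') := fun ρ' h =>
      (hK q hq).of_isClosed_subset (hM.1.inter isClosed_closedBall)
        (inter_subset_inter_right _ (closedBall_subset_closedBall h))
    obtain ⟨T, g, hTd, hT⟩ := hM.exists_isTangentParam hq.1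
    exact (uniformRollingBall_of_isCompact hM hu hq.1 hρ hρτ (hK q hq)).volume_le hq.1 hρ hTd hT
      (hT.rollingBall hu hq.1 hρ hρτ (hKs _ (by linarith))) (hKs _ (by linarith))
  have hufin : u.Finite := by
    have h1 := Measure.finite_const_le_meas_of_disjoint_iUnion (μHE[d] : Measure H)
      (ε := volume (closedBall (0 : EuclideanSpace ℝ (Fin d)) (ρ / 32)))
      (As := fun i : u => M ∩ closedBall (i : H) (ρ / 8))
      (measure_closedBall_pos _ _ (by positivity))
      (fun i => (hM.1.inter isClosed_closedBall).measurableSet)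
      (fun i j hij => ?_) (ne_top_of_le_ne_top hvol (measure_mono (by simp)))
    · have h2 : {i : u | volume (closedBall (0 : EuclideanSpace ℝ (Fin d)) (ρ / 32)) ≤
          μHE[d] (M ∩ closedBall (i : H) (ρ / 8))} = univ :=
        eq_univ_of_forall fun i => hvolle i (huX i.2)
      rw [h2] at h1
      exact Set.finite_coe_iff.1 (Set.finite_univ_iff.1 h1)
    · exact (hdisj i.2 j.2 (fun h => hij (Subtype.ext h))).mono inter_subset_right
        inter_subset_right
  refine (hufin.isCompact_biUnion fun q hq => hK q (huX hq)).of_isClosed_subset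
    (hM.1.inter isClosed_closedBall) fun q hq => ?_
  obtain ⟨b, hb, hqb⟩ := hcov q hq
  refine mem_biUnion hb ⟨hq.1, ?_⟩
  have h1 : q ∈ closedBall (id b) (5 * (ρ / 8)) :=
    hqb (mem_closedBall_self (by positivity))
  exact closedBall_subset_closedBall (by linarith) h1

/-- A bounded submanifold of finite volume and positive reach is compact. A noncompact piece of
radius `r` contains a point around which the piece of radius `r / 2` is noncompact, so the
submanifold would fail to be locally compact at a limit of such points. -/
theorem isCompact_of_hasUniqueNearest [MeasurableSpace H] [BorelSpace H] {d : ℕ} {M : Set H}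
    {τ : ℝ} (hM : IsSubmanifold 2 d M) (hτ : 0 < τ) (hu : HasUniqueNearest M τ)
    (hvol : μHE[d] M ≠ ∞) (hb : Bornology.IsBounded M) : IsCompact M := by
  by_contra hnc
  have hstep : ∀ (p : H) (r : ℝ), 0 < r → ¬ IsCompact (M ∩ closedBall p r) →
      ∃ q ∈ M ∩ closedBall p r, ¬ IsCompact (M ∩ closedBall q (r / 2)) := by
    intro p r hr hp
    by_contra! hcon
    refine hp (isCompact_inter_closedBall hM hu hvol (ρ := min τ (r / 8))
      (lt_min hτ (by positivity)) (min_le_left _ _) fun q hq => ?_)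
    refine (hcon q hq).of_isClosed_subset (hM.1.inter isClosed_closedBall)
      (inter_subset_inter_right _ (closedBall_subset_closedBall ?_))
    have := min_le_right τ (r / 8)
    linarith
  obtain ⟨r, hr, hMr⟩ := hb.subset_closedBall_lt 0 0
  -- `Z` consists of the balls in which `M` is not compact
  let Z := {x : H × ℝ // 0 < x.2 ∧ ¬ IsCompact (M ∩ closedBall x.1 x.2)}
  have hnext : ∀ x : Z, ∃ y : Z, y.1.1 ∈ M ∩ closedBall x.1.1 x.1.2 ∧ y.1.2 = x.1.2 / 2 := by
    rintro ⟨⟨p, r⟩, hr, hx⟩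
    obtain ⟨q, hq, hqc⟩ := hstep p r hr hx
    exact ⟨⟨(q, r / 2), by simpa using hr, hqc⟩, hq, rfl⟩
  choose next hnext1 hnext2 using hnext
  let x₀ : Z := ⟨(0, r), hr, by rwa [inter_eq_self_of_subset_left hMr]⟩
  let u : ℕ → Z := fun n => next^[n] x₀
  have husucc : ∀ n, u (n + 1) = next (u n) := fun n => Function.iterate_succ_apply' _ _ _
  have hrad : ∀ n, (u n).1.2 = r / 2 ^ n := by
    intro n
    induction n with
    | zero => simp [u, x₀]
    | succ n ih => rw [husucc, hnext2, ih, pow_succ]; field_simp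
  have hdist : ∀ n, dist (u n).1.1 (u (n + 1)).1.1 ≤ 2 * r / 2 / 2 ^ n := by
    intro n
    rw [husucc, dist_comm]
    have := (hnext1 (u n)).2
    rw [mem_closedBall, hrad] at this
    rwa [mul_div_cancel_left₀ _ (two_ne_zero)]
  obtain ⟨x, hx⟩ := cauchySeq_tendsto_of_complete (cauchySeq_of_le_geometric_two hdist)
  have hxM : x ∈ M := by
    refine hM.1.mem_of_tendsto (hx.comp (tendsto_add_atTop_nat 1)) (Eventually.of_forall fun n => ?_)
    simp only [Function.comp]
    rw [husucc]; exact (hnext1 (u n)).1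
  obtain ⟨T, g, hTd, hT⟩ := hM.exists_isTangentParam hxM
  have hfin : FiniteDimensional ℝ T := Module.finite_of_rank_eq_nat hTd
  obtain ⟨s, hs, hsc⟩ := hT.exists_isCompact hM.1
  have hlim : Tendsto (fun n => r / 2 ^ n + dist (u n).1.1 x) atTop (𝓝 (0 + 0)) := by
    refine Tendsto.add ?_ (tendsto_iff_dist_tendsto_zero.1 hx)
    simpa [div_eq_mul_inv] using (tendsto_pow_atTop_nhds_zero_of_lt_one (r := (2 : ℝ)⁻¹)
      (by norm_num) (by norm_num)).const_mul r
  rw [add_zero] at hlim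
  obtain ⟨n, hn⟩ := (hlim.eventually_le_const hs).exists
  refine (u n).2.2 (hsc.of_isClosed_subset (hM.1.inter isClosed_closedBall)
    (inter_subset_inter_right _ (closedBall_subset_closedBall' ?_)))
  rwa [hrad]

end Volume

/-! ### Reach and unique nearest points -/

section Reach

variable {H : Type*} [NormedAddCommGroup H]

theorem hasUniqueNearest_of_le_reach {M : Set H} (hne : M.Nonempty) {τ : ℝ}
    (h : ENNReal.ofReal τ ≤ reach M) : HasUniqueNearest M τ := by
  intro q hq
  have htop : infEDist q M ≠ ∞ := infEDist_ne_top hne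
  have h1 : infEDist q M < ENNReal.ofReal τ := by
    rw [← ENNReal.ofReal_toReal htop]
    exact (ENNReal.ofReal_lt_ofReal_iff (infDist_nonneg.trans_lt hq)).2 hq
  obtain ⟨ρ, hρ, hlt⟩ := lt_sSup_iff.1 (h1.trans_le h)
  have hiff : ∀ y, ‖q - y‖ = infDist q M ↔ edist q y = infEDist q M := by
    intro y
    rw [← dist_eq_norm, dist_edist, infDist, ENNReal.toReal_eq_toReal_iff' (edist_ne_top _ _) htop]
  obtain ⟨z, ⟨hzM, hz⟩, hu⟩ := hρ q hlt
  exact ⟨z, hzM, (hiff z).2 hz, fun y hy hyd => hu y ⟨hy, (hiff y).1 hyd⟩⟩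

theorem HasUniqueNearest.le_reach {M : Set H} {τ : ℝ} (h : HasUniqueNearest M τ) :
    ENNReal.ofReal τ ≤ reach M := by
  refine le_sSup fun q hq => ?_
  have htop : infEDist q M ≠ ∞ := (hq.trans_le le_top).ne
  have h1 : infDist q M < τ := by
    rw [← ENNReal.ofReal_toReal htop] at hq
    exact (ENNReal.ofReal_lt_ofReal_iff_of_nonneg ENNReal.toReal_nonneg).1 hq
  have hiff : ∀ y, ‖q - y‖ = infDist q M ↔ edist q y = infEDist q M := by
    intro y
    rw [← dist_eq_norm, dist_edist, infDist, ENNReal.toReal_eq_toReal_iff' (edist_ne_top _ _) htop]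
  obtain ⟨z, hzM, hz, hu⟩ := h q h1
  exact ⟨z, ⟨hzM, (hiff z).1 hz⟩, fun y hy => hu y hy.1 ((hiff y).2 hy.2)⟩

end Reach

variable {H : Type*} [NormedAddCommGroup H] [InnerProductSpace ℝ H]

/-! ### Projection onto a subspace containing a net -/

section Projection

theorem norm_sub_starProjection_le (W : Submodule ℝ H) [W.HasOrthogonalProjection] (w : H) :
    ‖w - W.starProjection w‖ ≤ ‖w‖ := by
  rw [← Submodule.starProjection_orthogonal_val]
  exact Submodule.norm_starProjection_apply_le _ _

/-- The orthogonal projection onto a subspace containing a net of `M` nearly fixes tangent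
vectors: a tangent vector of length `√ε τ` is a secant up to an error of `2ετ`, and a secant
is a difference of net points up to `2cετ`. -/
theorem norm_sub_starProjection_le_of_mem_tangent {M S : Set H} {τ c ε : ℝ} (hτ : 0 < τ) (hε : 0 < ε)
    (hε1 : ε < 1) (hS : IsNet (c * ε * τ) S M) (W : Submodule ℝ H) [W.HasOrthogonalProjection]
    (hSW : Submodule.span ℝ S ≤ W) {p : H} (hp : p ∈ M) (hU : UniformRollingBall M p τ)
    {T : Submodule ℝ H} {g : H → H} (hT : IsTangentParam M p T g) {v : H} (hv : v ∈ T) :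
    ‖v - W.starProjection v‖ ≤ (2 + 2 * c) * √ε * ‖v‖ := by
  wlog hv1 : ‖v‖ = 1 generalizing v with hwlog
  · rcases eq_or_ne v 0 with rfl | hv0
    · simp
    have hvpos : 0 < ‖v‖ := norm_pos_iff.2 hv0
    have h := hwlog (T.smul_mem ‖v‖⁻¹ hv) (norm_smul_inv_norm hv0)
    rw [map_smul, ← smul_sub, norm_smul, norm_smul, norm_inv, norm_norm,
      inv_mul_cancel₀ hvpos.ne', mul_one, inv_mul_le_iff₀ hvpos] at h
    linarith
  have hsq : √ε ^ 2 = ε := Real.sq_sqrt hε.le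
  have hs0 : 0 < √ε := Real.sqrt_pos.2 hε
  have hs1 : √ε < 1 := by rw [← Real.sqrt_one]; exact Real.sqrt_lt_sqrt hε.le hε1
  obtain ⟨a, ha, had⟩ := hU.exists_near hp hτ hT hv hv1 (s := √ε * τ) (by positivity) (by nlinarith)
  have had' : ‖a - (p + (√ε * τ) • v)‖ ≤ 2 * ε * τ := by
    refine had.trans (le_of_eq ?_)
    rw [mul_pow, hsq]; field_simp
  obtain ⟨a', ha', haa⟩ := hS.2 a ha
  obtain ⟨p', hp', hpp⟩ := hS.2 p hp
  rw [dist_eq_norm] at haa hpp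
  let Q : H → H := fun w => w - W.starProjection w
  have hQadd : ∀ x y, Q (x + y) = Q x + Q y := fun x y => by simp only [Q, map_add]; abel
  have hQ0 : Q (a' - p') = 0 := by
    have h1 : a' - p' ∈ W := W.sub_mem (hSW (Submodule.subset_span ha'))
      (hSW (Submodule.subset_span hp'))
    simp only [Q, Submodule.starProjection_eq_self_iff.2 h1, sub_self]
  have hQn : ∀ w, ‖Q w‖ ≤ ‖w‖ := norm_sub_starProjection_le W
  have h1 : Q ((√ε * τ) • v) =
      Q (-(a - (p + (√ε * τ) • v))) + Q (a - a') + Q (a' - p') + Q (-(p - p')) := by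
    rw [← hQadd, ← hQadd, ← hQadd]; congr 1; abel
  have h2 : ‖Q ((√ε * τ) • v)‖ ≤ 2 * ε * τ + c * ε * τ + c * ε * τ := by
    rw [h1, hQ0, add_zero]
    refine norm_add₃_le.trans ?_
    have h3 := hQn (-(a - (p + (√ε * τ) • v)))
    have h4 := hQn (a - a')
    have h5 := hQn (-(p - p'))
    rw [norm_neg] at h3 h5
    linarith
  have h3 : Q ((√ε * τ) • v) = (√ε * τ) • Q v := by simp only [Q, map_smul, smul_sub]
  rw [h3, norm_smul, Real.norm_of_nonneg (by positivity)] at h2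
  rw [hv1, mul_one]
  refine le_of_mul_le_mul_left (h2.trans (le_of_eq ?_)) (show 0 < √ε * τ by positivity)
  linear_combination (-(2 + 2 * c) * τ) * hsq

/-- The orthogonal projection onto a subspace containing a net of `M` nearly fixes secants. Long
secants are compared with differences of net points, short ones with tangent vectors. -/
theorem norm_sub_starProjection_le_of_mem {M S : Set H} {τ c ε : ℝ} (hc : 0 < c) (hτ : 0 < τ)
    (hε : 0 < ε) (hε1 : ε < 1) (hS : IsNet (c * ε * τ) S M) (W : Submodule ℝ H)
    [W.HasOrthogonalProjection] (hSW : Submodule.span ℝ S ≤ W) {p : H} (hp : p ∈ M)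
    (hU : UniformRollingBall M p τ) {T : Submodule ℝ H} [T.HasOrthogonalProjection] {g : H → H}
    (hT : IsTangentParam M p T g) (hroll : RollingBall M p T τ) {y : H} (hy : y ∈ M) :
    ‖(y - p) - W.starProjection (y - p)‖ ≤ (3 + 2 * c) * √ε * ‖y - p‖ := by
  have hsq : √ε ^ 2 = ε := Real.sq_sqrt hε.le
  have hs0 : 0 < √ε := Real.sqrt_pos.2 hε
  let Q : H → H := fun w => w - W.starProjection w
  have hQadd : ∀ x y, Q (x + y) = Q x + Q y := fun x y => by simp only [Q, map_add]; abel
  have hQn : ∀ w, ‖Q w‖ ≤ ‖w‖ := norm_sub_starProjection_le W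
  change ‖Q (y - p)‖ ≤ _
  rcases le_or_gt (√ε * τ) ‖y - p‖ with hfar | hnear
  · obtain ⟨y', hy', hyy⟩ := hS.2 y hy
    obtain ⟨p', hp', hpp⟩ := hS.2 p hp
    rw [dist_eq_norm] at hyy hpp
    have hQ0 : Q (y' - p') = 0 := by
      have h1 : y' - p' ∈ W := W.sub_mem (hSW (Submodule.subset_span hy'))
        (hSW (Submodule.subset_span hp'))
      simp only [Q, Submodule.starProjection_eq_self_iff.2 h1, sub_self]
    have h1 : Q (y - p) = Q (y - y') + Q (y' - p') + Q (-(p - p')) := by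
      rw [← hQadd, ← hQadd]; congr 1; abel
    have h2 : ‖Q (y - p)‖ ≤ c * ε * τ + c * ε * τ := by
      rw [h1, hQ0, add_zero]
      refine (norm_add_le _ _).trans ?_
      have h4 := hQn (y - y')
      have h5 := hQn (-(p - p'))
      rw [norm_neg] at h5
      linarith
    have h3 : c * ε * τ + c * ε * τ = 2 * c * √ε * (√ε * τ) := by
      linear_combination (-2 * c * τ) * hsq
    have h4 : 2 * c * √ε * (√ε * τ) ≤ 2 * c * √ε * ‖y - p‖ := by gcongr
    have h5 : 0 ≤ √ε * ‖y - p‖ := by positivity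
    linarith
  · have h1 : Q (y - p) = Q (T.starProjection (y - p)) + Q (y - p - T.starProjection (y - p)) := by
      rw [← hQadd]; congr 1; abel
    have h2 := norm_sub_starProjection_le_of_mem_tangent hτ hε hε1 hS W hSW hp hU hT
      (T.starProjection_apply_mem (y - p))
    have h3 : (2 + 2 * c) * √ε * ‖T.starProjection (y - p)‖ ≤ (2 + 2 * c) * √ε * ‖y - p‖ := by
      gcongr; exact T.norm_starProjection_apply_le _
    have h4 := (hQn _).trans (hroll.norm_sub_starProjection_le hy hτ)
    have h5 : ‖y - p‖ ^ 2 / (2 * τ) ≤ √ε * ‖y - p‖ := by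
      rw [div_le_iff₀ (by positivity)]
      nlinarith [norm_nonneg (y - p), mul_nonneg hs0.le (norm_nonneg (y - p))]
    rw [h1]
    refine (norm_add_le _ _).trans ?_
    change ‖Q (T.starProjection (y - p))‖ ≤ _ at h2
    linarith

theorem one_sub_mul_norm_sq_le (W : Submodule ℝ H) [W.HasOrthogonalProjection] {δ : ℝ}
    (hδ0 : 0 ≤ δ) (hδ1 : δ ≤ 1) {w : H} (h : ‖w - W.starProjection w‖ ≤ δ * ‖w‖) :
    (1 - δ) * ‖w‖ ^ 2 ≤ ‖W.starProjection w‖ ^ 2 := by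
  have h1 : ‖w‖ ^ 2 = ‖W.starProjection w‖ ^ 2 + ‖w - W.starProjection w‖ ^ 2 := by
    rw [Submodule.norm_sq_eq_add_norm_sq_starProjection w W, Submodule.starProjection_orthogonal_val]
  have h2 : ‖w - W.starProjection w‖ ^ 2 ≤ (δ * ‖w‖) ^ 2 := by gcongr
  have h3 : δ ^ 2 * ‖w‖ ^ 2 ≤ δ * ‖w‖ ^ 2 := by
    gcongr; nlinarith
  nlinarith

end Projection

/-! ### The projected manifold -/

section Image

/-- The displacement `n` of `q` from a nearest point of the image is normal to the image, so its
projection is normal to `M`, and the rolling ball condition of `M` bounds `⟪n, Π (y - x)⟫`. -/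
theorem hasUniqueNearest_image {M : Set H} {τ κ : ℝ} (hM : IsCompact M) (hne : M.Nonempty)
    (hτ : 0 < τ) (hκ : 0 < κ)
    (hU : ∀ p ∈ M, ∃ T g, IsTangentParam M p T g ∧ RollingBall M p T τ) (W : Submodule ℝ H)
    [W.HasOrthogonalProjection]
    (hW : ∀ x ∈ M, ∀ y ∈ M, κ * ‖x - y‖ ^ 2 ≤ ‖W.starProjection (x - y)‖ ^ 2) :
    HasUniqueNearest (W.starProjection '' M) (τ * κ) := by
  intro q hq
  obtain ⟨_, ⟨x, hx, rfl⟩, hxd⟩ := (hM.image W.starProjection.continuous).exists_infDist_eq_dist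
    (hne.image _) q
  refine ⟨_, ⟨x, hx, rfl⟩, by rw [← dist_eq_norm, hxd], ?_⟩
  rintro _ ⟨y, hy, rfl⟩ hyd
  rw [dist_eq_norm] at hxd
  set n := q - W.starProjection x with hn
  obtain ⟨T, g, hT, hroll⟩ := hU x hx
  have hnT : W.starProjection n ∈ Tᗮ := by
    rw [Submodule.mem_orthogonal']
    intro v hv
    have hmin : IsLocalMinOn (fun y => ‖q - W.starProjection y‖ ^ 2) M x :=
      eventually_nhdsWithin_of_forall fun y hy => by
        have h1 : ‖q - W.starProjection x‖ ≤ ‖q - W.starProjection y‖ := by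
          rw [← hn, ← hxd]; exact infDist_le_norm_sub ⟨y, hy, rfl⟩
        show ‖q - W.starProjection x‖ ^ 2 ≤ ‖q - W.starProjection y‖ ^ 2
        gcongr
    have hd : HasFDerivAt (fun y => q - W.starProjection y) (-W.starProjection) x :=
      W.starProjection.hasFDerivAt.const_sub q
    have h2 := hT.fderiv_eq_zero hmin hd.norm_sq hv
    have h3 : ⟪n, W.starProjection v⟫ = 0 := by simpa [← hn] using h2
    rwa [Submodule.inner_starProjection_left_eq_right]
  have h1 := hroll _ hnT y hy
  rw [Submodule.inner_starProjection_left_eq_right] at h1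
  have h2 := hW y hy x hx
  set w := W.starProjection (y - x) with hw
  have h3 : q - W.starProjection y = n - w := by rw [hw, hn, map_sub]; abel
  have h4 : ‖n - w‖ ^ 2 = ‖n‖ ^ 2 := by rw [← h3, hyd, hxd]
  rw [norm_sub_sq_real] at h4
  have h5 : ‖w‖ ^ 2 ≤ ‖n‖ * (‖w‖ ^ 2 / (τ * κ)) := by
    have h6 : ‖W.starProjection n‖ * ‖y - x‖ ^ 2 / (2 * τ) ≤ ‖n‖ * (‖w‖ ^ 2 / κ) / (2 * τ) := by
      have h7 : ‖y - x‖ ^ 2 ≤ ‖w‖ ^ 2 / κ := by rw [le_div_iff₀ hκ]; linarith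
      gcongr
      exact W.norm_starProjection_apply_le n
    have h8 : ‖n‖ * (‖w‖ ^ 2 / (τ * κ)) = 2 * (‖n‖ * (‖w‖ ^ 2 / κ) / (2 * τ)) := by
      field_simp
    linarith
  have h6 : ‖w‖ = 0 := by
    by_contra hw0
    have h7 : 0 < ‖w‖ ^ 2 := by positivity
    have h8 : ‖n‖ * (‖w‖ ^ 2 / (τ * κ)) < ‖w‖ ^ 2 := by
      rw [← mul_div_assoc, div_lt_iff₀ (by positivity), mul_comm (‖w‖ ^ 2)]
      exact mul_lt_mul_of_pos_right (hxd ▸ hq) h7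
    linarith
  have h7 : w = 0 := norm_eq_zero.1 h6
  rwa [hw, map_sub, sub_eq_zero] at h7

variable [CompleteSpace H]

/-- A set is a submanifold if near each of its points it is the image of a linear subspace under a
local diffeomorphism. -/
theorem isSubmanifold_of_exists_param {d : ℕ} {N : Set H} (hN : IsClosed N)
    (h : ∀ p ∈ N, ∃ (T : Submodule ℝ H) (G : H → H) (G' : H ≃L[ℝ] H), Module.rank ℝ T = d ∧
      ContDiffAt ℝ 2 G 0 ∧ G 0 = p ∧ HasFDerivAt G (G' : H →L[ℝ] H) 0 ∧
      (∀ᶠ y in 𝓝 (0 : H), y ∈ T → G y ∈ N) ∧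
      ∀ O ∈ 𝓝 (0 : H), ∀ᶠ m in 𝓝 p, m ∈ N → ∃ y ∈ O, y ∈ T ∧ G y = m) :
    IsSubmanifold 2 d N := by
  refine ⟨hN, fun p hp => ?_⟩
  obtain ⟨T, G, G', hTd, hG, hG0, hGd, hmaps, hsurj⟩ := h p hp
  let Φ := hG.toOpenPartialHomeomorph G hGd (by simp)
  have hΦ : (Φ : H → H) = G := rfl
  have h0 : (0 : H) ∈ Φ.source := hG.mem_toOpenPartialHomeomorph_source hGd (by simp)
  have hpt : p ∈ Φ.target := by
    have := Φ.map_source h0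
    rwa [hΦ, hG0] at this
  have hsymm0 : Φ.symm p = 0 := by
    rw [← hG0, ← hΦ, Φ.left_inv h0]
  obtain ⟨u, hu, hGu⟩ := hG.contDiffOn le_rfl (by simp)
  have hsymm : ContDiffAt ℝ 2 Φ.symm p := by
    refine Φ.contDiffAt_symm hpt (f₀' := G') ?_ ?_
    · rwa [hsymm0]
    · rwa [hsymm0]
  obtain ⟨w, hw, hGw⟩ := hsymm.contDiffOn le_rfl (by simp)
  -- shrink the neighbourhoods so that source and target of the chart match up on both sides
  set O : Set H := Φ.source ∩ u ∩ {y | y ∈ T → G y ∈ N} with hO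
  have hO0 : O ∈ 𝓝 (0 : H) :=
    inter_mem (inter_mem (Φ.open_source.mem_nhds h0) hu) hmaps
  set V : Set H := interior (Φ.symm ⁻¹' O ∩ w ∩ {m | m ∈ N → ∃ y ∈ O, y ∈ T ∧ G y = m}) with hV
  have hVp : p ∈ V := by
    rw [hV, mem_interior_iff_mem_nhds]
    refine inter_mem (inter_mem ((Φ.symm.continuousAt hpt).preimage_mem_nhds ?_) hw) (hsurj O hO0)
    rwa [hsymm0]
  have hVsub : V ⊆ Φ.symm ⁻¹' O ∩ w ∩ {m | m ∈ N → ∃ y ∈ O, y ∈ T ∧ G y = m} := interior_subset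
  let φ := Φ.symm.restrOpen V isOpen_interior
  have hφs : φ.source = Φ.target ∩ V := rfl
  have hφsymm : ∀ y, φ.symm y = G y := fun y => rfl
  have hφ : ∀ y, φ y = Φ.symm y := fun y => rfl
  have htO : ∀ y ∈ φ.target, y ∈ O ∧ y ∈ Φ.source := by
    intro y hy
    have h1 := φ.map_target hy
    have h2 := (hVsub h1.2).1.1
    have h3 := φ.right_inv hy
    rw [hφ] at h3
    rw [mem_preimage, h3] at h2
    exact ⟨h2, h2.1.1⟩
  refine ⟨φ, T.toAffineSubspace, ⟨hpt, hVp⟩, ?_, ?_, ?_, ?_⟩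
  · exact hGw.mono fun y hy => (hVsub hy.2).1.2
  · exact hGu.mono fun y hy => (htO y hy).1.1.2
  · rwa [Submodule.toAffineSubspace_direction]
  · ext y
    constructor
    · rintro ⟨m, ⟨hmN, hms⟩, rfl⟩
      refine ⟨?_, φ.map_source hms⟩
      obtain ⟨y, hyO, hyT, rfl⟩ := (hVsub hms.2).2 hmN
      have : φ (G y) = y := Φ.left_inv hyO.1.1
      rw [this]
      exact hyT
    · rintro ⟨hyT, hyt⟩
      exact ⟨G y, ⟨(htO y hyt).1.2 hyT, φ.map_target hyt⟩, φ.right_inv hyt⟩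

/-- If the projection is bi-Lipschitz on `M` and moves tangent vectors by a factor less than one,
the image is a submanifold. The local diffeomorphism is `Π ∘ g` on the tangent space, extended by
the identity on the normal space. -/
theorem isSubmanifold_image {d : ℕ} {M : Set H} (hM : IsSubmanifold 2 d M) (hMc : IsCompact M)
    (W : Submodule ℝ H) [W.HasOrthogonalProjection] {κ δ : ℝ} (hκ : 0 < κ) (hδ0 : 0 ≤ δ)
    (hδ1 : δ < 1) (hW : ∀ x ∈ M, ∀ y ∈ M, κ * ‖x - y‖ ^ 2 ≤ ‖W.starProjection (x - y)‖ ^ 2)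
    (hT : ∀ p ∈ M, ∀ T g, IsTangentParam M p T g →
      ∀ v ∈ T, ‖v - W.starProjection v‖ ≤ δ * ‖v‖) :
    IsSubmanifold 2 d (W.starProjection '' M) := by
  refine isSubmanifold_of_exists_param (hMc.image W.starProjection.continuous).isClosed ?_
  rintro _ ⟨p, hp, rfl⟩
  obtain ⟨T, g, hTd, hg⟩ := hM.exists_isTangentParam hp
  have hfin : FiniteDimensional ℝ T := Module.finite_of_rank_eq_nat hTd
  set P := T.starProjection with hP
  set B : H →L[ℝ] H := (ContinuousLinearMap.id ℝ H - W.starProjection).comp P with hB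
  have hBn : ‖B‖ < 1 := by
    refine lt_of_le_of_lt (B.opNorm_le_bound hδ0 fun y => ?_) hδ1
    refine (hT p hp T g hg (P y) (T.starProjection_apply_mem y)).trans ?_
    gcongr
    exact T.norm_starProjection_apply_le y
  -- the derivative `id - (id - Π) P` is invertible by the Neumann series
  let G' : H ≃L[ℝ] H := ContinuousLinearEquiv.unitsEquiv ℝ H (Units.oneSub B hBn)
  have hG' : (G' : H →L[ℝ] H) = ContinuousLinearMap.id ℝ H - B := rfl
  refine ⟨T, fun y => W.starProjection (g (P y)) + (y - P y), G', hTd, ?_, ?_, ?_, ?_, ?_⟩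
  · have h1 : ContDiffAt ℝ 2 (fun y => g (P y)) 0 :=
      ContDiffAt.comp (0 : H) (by simpa using hg.contDiffAt) P.contDiff.contDiffAt
    exact (W.starProjection.contDiff.contDiffAt.comp (0 : H) h1).add
      (contDiffAt_id.sub P.contDiff.contDiffAt)
  · simp [hg.map_zero]
  · rw [hG']
    have h1 : HasFDerivAt (fun y => g (P y)) P 0 := by
      have h2 : HasFDerivAt g (ContinuousLinearMap.id ℝ H) (P 0) := by simpa using hg.hasFDerivAt
      exact h2.comp (0 : H) P.hasFDerivAt
    have h3 := (W.starProjection.hasFDerivAt.comp (0 : H) h1).add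
      ((hasFDerivAt_id (0 : H)).sub P.hasFDerivAt)
    refine h3.congr_fderiv ?_
    ext y
    simp [hB]
    abel
  · filter_upwards [hg.mapsTo] with y hy hyT
    have hPy : P y = y := Submodule.starProjection_eq_self_iff.2 hyT
    rw [hPy, sub_self, add_zero]
    exact ⟨g y, hy hyT, rfl⟩
  · intro O hO
    obtain ⟨r, hr, hball⟩ := Metric.eventually_nhds_iff_ball.1 (hg.surj O hO)
    filter_upwards [ball_mem_nhds (W.starProjection p) (show 0 < √κ * r by positivity)]
    rintro _ hm ⟨m, hmM, rfl⟩
    have hmr : m ∈ ball p r := by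
      rw [mem_ball, dist_eq_norm] at hm ⊢
      rw [← map_sub] at hm
      have h1 := hW m hmM p hp
      by_contra! hcon
      have h2 : ‖W.starProjection (m - p)‖ ^ 2 < (√κ * r) ^ 2 := by gcongr
      rw [mul_pow, Real.sq_sqrt hκ.le] at h2
      have h3 : κ * r ^ 2 ≤ κ * ‖m - p‖ ^ 2 := by gcongr
      linarith
    obtain ⟨y, hyO, hyT, rfl⟩ := hball m hmr hmM
    refine ⟨y, hyO, hyT, ?_⟩
    have hPy : P y = y := Submodule.starProjection_eq_self_iff.2 hyT
    simp only [hPy, sub_self, add_zero]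

end Image

end ManifoldApprox

theorem mainTheorem7 (d : ℕ) (c : ℝ) (hc : 0 < c) :
    ∃ C : ℝ, 0 < C ∧
      ∀ (H : Type*) [NormedAddCommGroup H] [InnerProductSpace ℝ H] [CompleteSpace H]
        [TopologicalSpace.SeparableSpace H] [MeasurableSpace H] [BorelSpace H]
        (V τ ε : ℝ), 0 < V → 0 < τ → τ < 1 → 0 < ε →
        ∀ M ∈ ManifoldApprox.manifoldClass H d V τ,
        ∀ S : Set H, ManifoldApprox.IsNet (c * ε * τ) S M →
        ∀ (W : Submodule ℝ H) [W.HasOrthogonalProjection], Submodule.span ℝ S ≤ W →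
          (∀ x ∈ M, ∀ y ∈ M,
            (1 - C * Real.sqrt ε) * ‖x - y‖ ≤ ‖W.starProjection (x - y)‖) ∧
          (C * Real.sqrt ε < 1 →
            ManifoldApprox.IsSubmanifold 2 d (W.starProjection '' M) ∧
            W.starProjection '' M ∈
              ManifoldApprox.manifoldClass H d V (τ * (1 - C * Real.sqrt ε))) := by
  refine ⟨3 + 2 * c, by positivity, ?_⟩
  intro H _ _ _ _ _ _ V τ ε hV hτ hτ1 hε M hM S hS W _ hSW
  obtain ⟨hMs, hM1, hvol, hreach⟩ := hM
  rcases M.eq_empty_or_nonempty with rfl | hne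
  · refine ⟨by simp, fun _ => ?_⟩
    have hsub : ManifoldApprox.IsSubmanifold 2 d (W.starProjection '' (∅ : Set H)) :=
      ⟨by simp, by simp⟩
    refine ⟨hsub, hsub, by simp, by simp, ?_⟩
    refine le_sSup fun x hx => ?_
    simp at hx
  rcases le_or_gt 1 ((3 + 2 * c) * √ε) with hbig | hsmall
  · refine ⟨fun x _ y _ => ?_, fun h => absurd h (not_lt.2 hbig)⟩
    exact (mul_nonpos_of_nonpos_of_nonneg (by linarith) (norm_nonneg _)).trans (norm_nonneg _)
  have hs0 : 0 < √ε := Real.sqrt_pos.2 hε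
  have hs1 : √ε < 1 := by nlinarith
  have hε1 : ε < 1 := by
    rw [← Real.sqrt_lt_sqrt_iff hε.le, Real.sqrt_one]; exact hs1
  have hu := ManifoldApprox.hasUniqueNearest_of_le_reach hne hreach
  have hMc : IsCompact M := ManifoldApprox.isCompact_of_hasUniqueNearest hMs hτ hu
    (ne_top_of_le_ne_top ENNReal.ofReal_ne_top hvol) (Metric.isBounded_closedBall.subset hM1)
  have hK : ∀ p r, IsCompact (M ∩ Metric.closedBall p r) := fun p r =>
    hMc.inter_right Metric.isClosed_closedBall
  have hU : ∀ p ∈ M, ManifoldApprox.UniformRollingBall M p τ := fun p hp =>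
    ManifoldApprox.uniformRollingBall_of_isCompact hMs hu hp hτ le_rfl (hK _ _)
  have hδ0 : 0 ≤ (3 + 2 * c) * √ε := by positivity
  have hκ : 0 < 1 - (3 + 2 * c) * √ε := by linarith
  have hW : ∀ x ∈ M, ∀ y ∈ M,
      (1 - (3 + 2 * c) * √ε) * ‖x - y‖ ^ 2 ≤ ‖W.starProjection (x - y)‖ ^ 2 := by
    intro y hy p hp
    obtain ⟨T, g, hTd, hT⟩ := hMs.exists_isTangentParam hp
    have hfin : FiniteDimensional ℝ T := Module.finite_of_rank_eq_nat hTd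
    exact ManifoldApprox.one_sub_mul_norm_sq_le W hδ0 hsmall.le
      (ManifoldApprox.norm_sub_starProjection_le_of_mem hc hτ hε hε1 hS W hSW hp (hU p hp) hT
        (hT.rollingBall hu hp hτ le_rfl (hK _ _)) hy)
  have hsub : ManifoldApprox.IsSubmanifold 2 d (W.starProjection '' M) := by
    refine ManifoldApprox.isSubmanifold_image hMs hMc W hκ hδ0 hsmall hW fun p hp T g hT v hv => ?_
    refine (ManifoldApprox.norm_sub_starProjection_le_of_mem_tangent hτ hε hε1 hS W hSW hp
      (hU p hp) hT hv).trans ?_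
    gcongr
    norm_num
  refine ⟨fun x hx y hy => ?_, fun _ => ⟨hsub, hsub, ?_, ?_, ?_⟩⟩
  · refine le_of_sq_le_sq ?_ (norm_nonneg _)
    refine le_trans ?_ (hW x hx y hy)
    rw [mul_pow]
    gcongr
    nlinarith
  · rintro _ ⟨x, hx, rfl⟩
    have h1 : ‖x‖ ≤ 1 := by simpa using hM1 hx
    simpa using (W.norm_starProjection_apply_le x).trans h1
  · refine (ManifoldApprox.euclideanHausdorffMeasure_image_le ?_ d M).trans hvol
    refine LipschitzWith.of_dist_le_mul fun x y => ?_
    rw [dist_eq_norm, ← map_sub, NNReal.coe_one, one_mul, dist_eq_norm]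
    exact W.norm_starProjection_apply_le _
  · refine (ManifoldApprox.hasUniqueNearest_image hMc hne hτ hκ (fun p hp => ?_) W hW).le_reach
    obtain ⟨T, g, hT, hroll⟩ := (hU p hp).rolling p hp (by simp [hτ.le])
    exact ⟨T, g, hT, hroll⟩
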